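/- Let $k\ge 3$ be an odd integer, let $i\ge 0$ be an integer with $\gcd(i,k)=1$, let $0\le t\le k-1$, put $e=(2^i+1)\cdot 2^t$, and let $\mathbb F=\mathbb F_{2^k}$. Then $x\mapsto x^e$ is a permutation of $\mathbb F$. For $z\in\mathbb F$ let $R_z$ be the permutation $R_z(x)=(x+z)^e+z^e$ of $\mathbb F$, and define the open and the closed butterfly (with coefficient $1$) on $\mathbb F^2$ by $$H_e^1(x,y)=\bigl(R_{R_y^{-1}(x)}(y),\,R_y^{-1}(x)\bigr),\qquad V_e^1(x,y)=\bigl(R_x(y),\,R_y(x)\bigr).$$ For $G=(G_1,G_2):\mathbb F^2\to\mathbb F^2$: * the algebraic degree of $G$ is the maximum of $w_2(r)+w_2(s)$ over all monomials $x^ry^s$ that occur with a nonzero coefficient in $G_1$ or $G_2$, each written as its unique polynomial of degree at most $2^k-1$ in each of $x,y$; here $w_2$ is the number of ones in the binary expansion; * $\delta_G(a,b)=|\{x\in\mathbb F^2: G(x+a)+G(x)=b\}|$; the differential spectrum of $G$ is the set $\{\delta_G(a,b): a,b\in\mathbb F^2,\ a\ne 0\}$, and the differential uniformity is its maximum; *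 with $\operatorname{Tr}$ the absolute trace of $\mathbb F$ and $\langle(u_1,u_2),(v_1,v_2)\rangle=\operatorname{Tr}(u_1v_1+u_2v_2)$, put $\mathcal W_G(a,b)=\sum_{x\in\mathbb F^2}(-1)^{\langle b,G(x)\rangle+\langle a,x\rangle}$; the Walsh spectrum of $G$ is the set $\{\mathcal W_G(a,b): a,b\in\mathbb F^2,\ b\neq 0\}$, and the nonlinearity is $2^{2k-1}-\frac12\max_{a,\,b\ne0}|\mathcal W_G(a,b)|$. Then: 1. Both $H_e^1$ and $V_e^1$ are permutations of $\mathbb F^2$. 2. The algebraic degrees of $H_e^1$ and $V_e^1$ are $k$ and $2$, respectively. 3. Both $H_e^1$ and $V_e^1$ have differential uniformity $4$, and the differential spectrum of each of them is $\{0,4\}$. 4. Both $H_e^1$ and $V_e^1$ have nonlinearity $2^{2k-1}-2^k$ (the best value known for functions in dimension $2k$), and the Walsh spectrum of each of them is $\{0,2^{k+1},-2^{k+1}\}$. -/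

import Mathlib

namespace Butterfly

section Structures

variable {F : Type*} [Field F]

/-- The keyed permutation `R_z[e,α](x) = (x + α z)^e + z^e` of `F`, for an exponent `e` such that
`x ↦ x^e` is a permutation of `F`. -/
noncomputable def keyedPerm {e : ℕ} (he : Function.Bijective (fun x : F => x ^ e)) (α z : F) :
    Equiv.Perm F :=
  ((Equiv.addRight (α * z)).trans (Equiv.ofBijective _ he)).trans (Equiv.addRight (z ^ e))

theorem keyedPerm_apply {e : ℕ} (he : Function.Bijective (fun x : F => x ^ e)) (α z x : F) :
    keyedPerm he α z x = (x + α * z) ^ e + z ^ e := rfl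

/-- The open butterfly `H_e^α(x,y) = (R_{R_y⁻¹(x)}(y), R_y⁻¹(x))`. -/
noncomputable def openButterfly {e : ℕ} (he : Function.Bijective (fun x : F => x ^ e)) (α : F) :
    F × F → F × F :=
  fun p => (keyedPerm he α ((keyedPerm he α p.2).symm p.1) p.2, (keyedPerm he α p.2).symm p.1)

/-- The closed butterfly `V_e^α(x,y) = (R_x(y), R_y(x))`. -/
noncomputable def closedButterfly {e : ℕ} (he : Function.Bijective (fun x : F => x ^ e)) (α : F) :
    F × F → F × F :=
  fun p => (keyedPerm he α p.1 p.2, keyedPerm he α p.2 p.1)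

end Structures

section AlgebraicDegree

variable {F : Type*} [Field F] [Fintype F]

/-- Every function `F × F → F` on a finite field with `q` elements is given by exactly one
polynomial in two variables of degree less than `q` in each of them. -/
theorem existsUnique_reducedPoly (f : F × F → F) :
    ∃! p : MvPolynomial (Fin 2) F,
      (∀ j, p.degreeOf j < Fintype.card F) ∧ ∀ x y, MvPolynomial.eval ![x, y] p = f (x, y) := by
  classical
  have hq : 0 < Fintype.card F := Fintype.card_pos
  have hex : (fun v : Fin 2 → F => f (v 0, v 1)) ∈
      (MvPolynomial.restrictDegree (Fin 2) F (Fintype.card F - 1)).map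
        (MvPolynomial.evalₗ F (Fin 2)) := by
    rw [MvPolynomial.map_restrict_dom_evalₗ]
    trivial
  obtain ⟨p, hp, hpf⟩ := hex
  refine ⟨p, ⟨fun j => ?_, fun x y => ?_⟩, ?_⟩
  · rw [MvPolynomial.degreeOf_lt_iff hq]
    intro m hm
    have := (MvPolynomial.mem_restrictDegree (Fin 2) p _).1 hp m hm j
    omega
  · simpa using congrFun hpf ![x, y]
  · rintro r ⟨hr, hrf⟩
    rw [← sub_eq_zero]
    refine MvPolynomial.eq_zero_of_eval_zero_at_prod_finset _ (fun _ => Finset.univ) ?_ ?_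
    · intro j
      rw [MvPolynomial.degreeOf_lt_iff (by simpa using hq)]
      intro m hm
      have hp' : p.degreeOf j < Fintype.card F := by
        rw [MvPolynomial.degreeOf_lt_iff hq]
        intro m hm
        have := (MvPolynomial.mem_restrictDegree (Fin 2) p _).1 hp m hm j
        omega
      rw [Finset.card_univ]
      rcases Finset.mem_union.1 (MvPolynomial.support_sub _ _ _ hm) with h | h
      · exact (MvPolynomial.degreeOf_lt_iff hq).1 (hr j) m h
      · exact (MvPolynomial.degreeOf_lt_iff hq).1 hp' m h
    · intro v _
      have h1 := hrf (v 0) (v 1)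
      have h2 := congrFun hpf v
      have hv : ![v 0, v 1] = v := by ext j; fin_cases j <;> rfl
      rw [hv] at h1
      simp only [MvPolynomial.evalₗ_apply] at h2
      rw [map_sub, h1, h2, sub_self]

/-- The reduced bivariate polynomial `∑ c_{ij} x^i y^j`, `0 ≤ i, j ≤ q - 1`, representing `f`. -/
noncomputable def reducedPoly (f : F × F → F) : MvPolynomial (Fin 2) F :=
  (existsUnique_reducedPoly f).choose

/-- The 2-weight of `l`: the number of nonzero binary digits. -/
def twoWeight (l : ℕ) : ℕ := (Nat.digits 2 l).sum

/-- The algebraic degree of `f : F × F → F`: the maximum of `w₂(i) + w₂(j)` over the monomials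
`x^i y^j` that occur in the reduced polynomial of `f`. -/
noncomputable def algDegreeCoord (f : F × F → F) : ℕ :=
  (reducedPoly f).support.sup (fun m => twoWeight (m 0) + twoWeight (m 1))

/-- The algebraic degree of `G : F × F → F × F`: the larger of the degrees of its two
components. -/
noncomputable def algDegree (G : F × F → F × F) : ℕ :=
  max (algDegreeCoord (fun p => (G p).1)) (algDegreeCoord (fun p => (G p).2))

end AlgebraicDegree

section Differential

variable {V : Type*} [AddCommGroup V] [Fintype V]

/-- `δ_G(a,b)`, the number of `x` with `G(x + a) + G(x) = b`. -/
noncomputable def diffCount (G : V → V) (a b : V) : ℕ :=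
  Nat.card {x : V // G (x + a) + G x = b}

/-- The differential spectrum `{δ_G(a,b) : a ≠ 0, b}`. -/
def diffSpectrum (G : V → V) : Set ℕ :=
  {m | ∃ a b : V, a ≠ 0 ∧ diffCount G a b = m}

open Classical in
/-- The differential uniformity `max {δ_G(a,b) : a ≠ 0, b}`. -/
noncomputable def diffUniformity (G : V → V) : ℕ :=
  (Finset.univ.filter (fun ab : V × V => ab.1 ≠ 0)).sup (fun ab => diffCount G ab.1 ab.2)

end Differential

section Walsh

variable {F : Type*} [Field F] [Fintype F] [Algebra (ZMod 2) F]

/-- The Walsh transform of `G : F × F → F × F`, with respect to the pairing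
`⟨(a,b),(x,y)⟩ = Tr(a x + b y)`, where `Tr` is the absolute trace of `F`. -/
noncomputable def walsh (G : F × F → F × F) (a b : F × F) : ℤ :=
  ∑ x : F × F, (-1 : ℤ) ^ (Algebra.trace (ZMod 2) F
    (b.1 * (G x).1 + b.2 * (G x).2 + a.1 * x.1 + a.2 * x.2)).val

/-- The Walsh spectrum `{W_G(a,b) : a, b ≠ 0}`. -/
def walshSpectrum (G : F × F → F × F) : Set ℤ :=
  {w | ∃ a b : F × F, b ≠ 0 ∧ walsh G a b = w}

open Classical in
/-- The nonlinearity `2^(n-1) - (1/2) max {|W_G(a,b)| : a, b ≠ 0}`, where `2^n` is the number of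
elements of `F × F`. -/
noncomputable def nonlinearity (G : F × F → F × F) : ℚ :=
  (Fintype.card (F × F) : ℚ) / 2 - (1 / 2) *
    (((Finset.univ.filter (fun ab : (F × F) × (F × F) => ab.2 ≠ 0)).sup
      (fun ab => (walsh G ab.1 ab.2).natAbs) : ℕ) : ℚ)

end Walsh

end Butterfly

/-! Put q = 2^k, let `s` be x ↦ x^(2^i) and `τ` be x ↦ x^(2^t), so that x^e = τ(x)·s(τ(x)). Since k
is odd, ω² = ω + 1 has no root in F, and K = F(ω) is a field; extend `s` to K by fixing ω. As
gcd(2i, k) = 1, both s and s² have fixed field F_4 in K.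

Expanding u·s(u) in the basis 1, ω shows that V is the Gold map u ↦ u·s(u) of K between additive
bijections (`closedButterfly_eq_gold`). The Gold map is injective. Its derivative in direction a is
affine with kernel a·F_4, hence four-to-one onto its image (`card_gold_derivative`). Its components
are quadratic forms with radical of order 4, so squared Walsh coefficients are 0 or 4q²
(`sq_walsh_closedButterfly`). Bijectivity and the first two moments of the Walsh transform show that
all these values occur.

Moreover H(x, y) = (u, v) exactly when V(v, y) = (u, x). The two graphs differ by a permutation of
coordinates, so differential and Walsh data pass from V to H, and H is an involution.

The degree of H needs an explicit inverse. With z = x^(2^(k-t)) + y·y^(2^i), the e-th root of x +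
y^e is W = ∏ z^(2^(2ij)), 0 ≤ j ≤ (k-1)/2: the product W·W^(2^i) is the norm of z, which is 0 or 1,
times one further conjugate equal to z. The formal top part of W, of degree k + 1, is by the same
identity just y, so W has degree at most k. In the first coordinate two terms of degree k + 1
cancel. If W had degree below k, a function of degree below 2k would have nonzero sum over F². -/

namespace Butterfly

/-! ### The Gold map on the quadratic extension -/

section QuadraticExtension

/-- The extension `F(ω)` of `F` with `ω² = ω + 1`. -/
abbrev QuadExt (F : Type*) [Field F] := QuadraticAlgebra F 1 1

variable {F : Type*} [Field F]

/-- The endomorphism of `F(ω)` that extends an endomorphism of `F` and fixes `ω`. -/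
def quadMap (s : F →+* F) : QuadExt F →+* QuadExt F where
  toFun u := ⟨s u.re, s u.im⟩
  map_one' := by ext <;> simp [QuadraticAlgebra.re_one, QuadraticAlgebra.im_one]
  map_zero' := by ext <;> simp
  map_mul' u v := by ext <;> simp
  map_add' u v := by ext <;> simp

@[simp] theorem re_quadMap (s : F →+* F) (u : QuadExt F) : (quadMap s u).re = s u.re := rfl

@[simp] theorem im_quadMap (s : F →+* F) (u : QuadExt F) : (quadMap s u).im = s u.im := rfl

instance [CharP F 2] : CharP (QuadExt F) 2 :=
  charP_of_injective_algebraMap QuadraticAlgebra.algebraMap_injective 2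

/-- The generalised Gold function `u ↦ u · s(u)` of `F(ω)`. -/
def gold (s : F →+* F) (u : QuadExt F) : QuadExt F := u * quadMap s u

theorem gold_add (s : F →+* F) (u v : QuadExt F) :
    gold s (u + v) = gold s u + gold s v + (u * quadMap s v + v * quadMap s u) := by
  simp only [gold, map_add]; ring

theorem gold_mul (s : F →+* F) (u v : QuadExt F) : gold s (u * v) = gold s u * gold s v := by
  simp only [gold, map_mul]; ring

theorem quadMap_eq_self_of_quadMap_quadMap {s : F →+* F}
    (hs : ∀ x, s (s x) = x → x = 0 ∨ x = 1) {u : QuadExt F}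
    (hu : quadMap s (quadMap s u) = u) : quadMap s u = u := by
  have h (x : F) (hx : s (s x) = x) : s x = x := by
    rcases hs x hx with rfl | rfl <;> simp
  ext
  · exact h _ (congrArg QuadraticAlgebra.re hu)
  · exact h _ (congrArg QuadraticAlgebra.im hu)

/-- Both coordinates of a fixed point lie in the fixed field F_2 of `s`, so the fixed points form
F_2(ω) = F_4. -/
theorem card_fixed_quadMap {s : F →+* F} (hs : ∀ x, s (s x) = x → x = 0 ∨ x = 1) :
    Nat.card {u : QuadExt F // quadMap s u = u} = 4 := by
  have h2 : Nat.card {x : F // s x = x} = 2 := by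
    have : {x : F | s x = x} = {0, 1} := by
      ext x
      refine ⟨fun hx => hs x ?_, ?_⟩
      · rw [hx, hx]
      · rintro (rfl | rfl) <;> simp
    rw [← Set.coe_ofPred, Nat.card_coe_set_eq, this, Set.ncard_pair zero_ne_one]
  have e : {u : QuadExt F // quadMap s u = u} ≃ {x : F // s x = x} × {x : F // s x = x} :=
    { toFun u := (⟨u.1.re, congrArg QuadraticAlgebra.re u.2⟩,
        ⟨u.1.im, congrArg QuadraticAlgebra.im u.2⟩)
      invFun p := ⟨⟨p.1.1, p.2.1⟩, QuadraticAlgebra.ext p.1.2 p.2.2⟩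
      left_inv _ := rfl
      right_inv _ := rfl }
  rw [Nat.card_congr e, Nat.card_prod, h2]

variable [CharP F 2] [Fact (∀ r : F, r ^ 2 ≠ 1 + 1 * r)]

/-- By multiplicativity it suffices to treat w·s(w) = 1. Applying `s` gives s²(w) = w, hence s(w) =
w and w² = 1, so w = 1 in characteristic two. -/
theorem gold_injective {s : F →+* F} (hs : ∀ x, s (s x) = x → x = 0 ∨ x = 1) :
    Function.Injective (gold s) := by
  intro u v huv
  by_cases hv : v = 0
  · subst hv
    simpa [gold] using huv
  have hv' : quadMap s v ≠ 0 := by simpa using hv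
  set w := u / v with hw
  have hu : u = w * v := by rw [hw, div_mul_cancel₀ _ hv]
  have hgv : gold s v ≠ 0 := mul_ne_zero hv hv'
  have h1 : w * quadMap s w = 1 := by
    rw [hu, gold_mul] at huv
    exact mul_right_cancel₀ hgv (huv.trans (one_mul _).symm)
  have h2 : quadMap s w * quadMap s (quadMap s w) = 1 := by
    rw [← map_mul, h1, map_one]
  have h3 : quadMap s (quadMap s w) = w := by
    rw [eq_comm, ← mul_right_inj' (left_ne_zero_of_mul_eq_one h2), h2, mul_comm, h1]
  rw [quadMap_eq_self_of_quadMap_quadMap hs h3] at h1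
  have h4 : (w + 1) ^ 2 = 0 := by
    rw [CharTwo.add_sq, sq w, h1, one_pow, CharTwo.add_self_eq_zero]
  have h5 : w = 1 := CharTwo.add_eq_zero.1 (pow_eq_zero_iff two_ne_zero |>.1 h4)
  rw [hu, h5, one_mul]

/-- The derivatives of the Gold function are four-to-one. -/
theorem card_gold_derivative {s : F →+* F} (hs : ∀ x, s (s x) = x → x = 0 ∨ x = 1)
    {a : QuadExt F} (ha : a ≠ 0) (b : QuadExt F) :
    Nat.card {u : QuadExt F // gold s (u + a) + gold s u = b} = 0 ∨
      Nat.card {u : QuadExt F // gold s (u + a) + gold s u = b} = 4 := by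
  by_cases h : ∃ u, gold s (u + a) + gold s u = b
  · obtain ⟨u₀, hu₀⟩ := h
    right
    rw [← card_fixed_quadMap hs]
    -- Substituting u = d·a + u₀ turns the equation into a·s(a)·(s(d) + d) = 0, so the solutions
    -- correspond to the fixed points of `s`.
    refine (Nat.card_congr (Equiv.subtypeEquiv
      ((Equiv.mulRight₀ a ha).trans (Equiv.addRight u₀)) fun d => ?_)).symm
    have key : gold s (d * a + u₀ + a) + gold s (d * a + u₀) + b
        = a * quadMap s a * (quadMap s d + d) := by
      rw [← hu₀]
      simp only [gold_add, map_mul]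
      simp only [gold, map_mul, map_add]
      have h2 : (2 : QuadExt F) = 0 := CharTwo.two_eq_zero
      linear_combination (d * a * quadMap s d * quadMap s a + 2 * u₀ * quadMap s u₀
        + d * a * quadMap s u₀ + u₀ * quadMap s d * quadMap s a + u₀ * quadMap s a + a * quadMap s u₀ + a * quadMap s a) * h2
    change _ ↔ gold s (d * a + u₀ + a) + gold s (d * a + u₀) = b
    rw [← CharTwo.add_eq_zero, ← CharTwo.add_eq_zero (a := gold s _ + _), key]
    simp [ha]
  · left
    push Not at h
    have : IsEmpty {u : QuadExt F // gold s (u + a) + gold s u = b} := ⟨fun u => h u.1 u.2⟩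
    exact Nat.card_of_isEmpty

end QuadraticExtension

/-! ### Exponential sums of quadratic functions -/

section QuadraticSums

/-- The sign `(-1)^z` of `z : ZMod 2`. -/
def sign (z : ZMod 2) : ℤ := (-1) ^ z.val

theorem sign_add (y z : ZMod 2) : sign (y + z) = sign y * sign z := by
  revert y z; decide

@[simp] theorem sign_zero : sign 0 = 1 := rfl

theorem sum_sign_addMonoidHom {V : Type*} [AddCommGroup V] [Fintype V] (L : V →+ ZMod 2)
    [Decidable (L = 0)] : ∑ v, sign (L v) = if L = 0 then (Fintype.card V : ℤ) else 0 := by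
  split_ifs with h
  · simp [h]
  · obtain ⟨v₀, hv₀⟩ := DFunLike.ne_iff.1 h
    have hs : sign (L v₀) = -1 := by
      revert hv₀
      change L v₀ ≠ 0 → _
      generalize L v₀ = z
      revert z; decide
    have := Equiv.sum_comp (Equiv.addRight v₀) (fun v => sign (L v))
    simp only [Equiv.coe_addRight, map_add, sign_add, ← Finset.sum_mul, hs] at this
    linarith

/-- The square of the sum of signs of a quadratic function with given radical. -/
theorem sq_sum_sign_of_polar {V : Type*} [AddCommGroup V] [Fintype V] (Q : V → ZMod 2)
    (B : V → V →+ ZMod 2) (hQ : ∀ u w, Q (u + w) = Q u + Q w + B w u) (R : AddSubgroup V)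
    (hR : ∀ w, w ∈ R ↔ B w = 0) :
    (∑ u, sign (Q u)) ^ 2 = 0 ∨
      (∑ u, sign (Q u)) ^ 2 = (Fintype.card V : ℤ) * (Nat.card R : ℤ) := by
  classical
  have hsq : ∀ z : ZMod 2, sign z * sign z = 1 := by decide
  -- In the double sum put v = u + w: the factor `sign (Q u)` squares to 1, leaving a character sum
  -- over u that vanishes unless w lies in the radical.
  have h1 : (∑ u, sign (Q u)) ^ 2 = ∑ w, sign (Q w) * ∑ u, sign (B w u) := by
    rw [sq, Finset.sum_mul_sum]
    have h2 (u : V) : ∑ v, sign (Q u) * sign (Q v) = ∑ w, sign (Q w) * sign (B w u) := by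
      rw [← Equiv.sum_comp (Equiv.addLeft u)]
      refine Finset.sum_congr rfl fun w _ => ?_
      rw [Equiv.coe_addLeft, hQ, sign_add, sign_add, ← mul_assoc, ← mul_assoc, hsq, one_mul]
    simp_rw [h2]
    rw [Finset.sum_comm]
    simp_rw [Finset.mul_sum]
  have h3 : (∑ u, sign (Q u)) ^ 2 = (Fintype.card V : ℤ) * ∑ w : R, sign (Q w) := by
    rw [h1]
    simp_rw [sum_sign_addMonoidHom, mul_ite, mul_zero, ← hR]
    rw [← Finset.sum_filter, Finset.mul_sum, ← Finset.sum_subtype_eq_sum_filter]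
    simp only [mul_comm (Fintype.card V : ℤ)]
    exact Finset.sum_bij' (fun w _ => ⟨w.1, by simp⟩) (fun w _ => ⟨w.1, by simp⟩)
      (by simp) (by simp) (by simp) (by simp) (by simp)
  -- On the radical `Q` is additive, so the remaining sum is 0 or the order of `R`.
  let L : R →+ ZMod 2 := AddMonoidHom.mk' (fun w => Q w) fun u w => by
    simp [hQ u w, (hR w).1 w.2]
  have h4 : ∑ w : R, sign (Q w) = if L = 0 then (Fintype.card R : ℤ) else 0 :=
    sum_sign_addMonoidHom L
  rw [h3, h4, Nat.card_eq_fintype_card]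
  split_ifs <;> simp

end QuadraticSums

/-! ### Attained values of the differential spectrum -/

section Attained

variable {V : Type*} [AddCommGroup V] [Fintype V]

/-- A permutation of an elementary abelian `2`-group whose derivatives are four-to-one has
differential spectrum `{0, 4}`. -/
theorem diffSpectrum_eq_of_bijective [Nontrivial V] (hV : ∀ v : V, v + v = 0) {G : V → V}
    (hG : Function.Bijective G)
    (h : ∀ a b : V, a ≠ 0 → diffCount G a b = 0 ∨ diffCount G a b = 4) :
    diffSpectrum G = {0, 4} := by
  obtain ⟨a, ha⟩ := exists_ne (0 : V)
  ext m
  constructor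
  · rintro ⟨a, b, hab, rfl⟩
    exact h a b hab
  · rintro (rfl | rfl)
    -- The value 0 occurs at b = 0 by injectivity; the value 4 occurs at any b in the image of a
    -- derivative.
    · refine ⟨a, 0, ha, ?_⟩
      have : IsEmpty {x : V // G (x + a) + G x = 0} := by
        refine ⟨fun x => ha ?_⟩
        have h1 : G (x.1 + a) = G x.1 := by
          rw [eq_neg_of_add_eq_zero_left x.2, ← eq_neg_of_add_eq_zero_left (hV _)]
        simpa using hG.1 h1
      exact Nat.card_of_isEmpty
    · refine ⟨a, G (0 + a) + G 0, ha, (h _ _ ha).resolve_left ?_⟩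
      have : Nonempty {x : V // G (x + a) + G x = G (0 + a) + G 0} := ⟨⟨0, rfl⟩⟩
      exact Nat.card_pos.ne'

theorem diffUniformity_eq_of_diffSpectrum {G : V → V} {m : ℕ} (h : diffSpectrum G = {0, m}) :
    diffUniformity G = m := by
  classical
  apply le_antisymm
  · refine Finset.sup_le fun ab hab => ?_
    have : diffCount G ab.1 ab.2 ∈ diffSpectrum G := ⟨_, _, by simpa using hab, rfl⟩
    rw [h] at this
    rcases this with h0 | h0 <;> rw [h0]
    exact Nat.zero_le _
  · have : m ∈ diffSpectrum G := by simp [h]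
    obtain ⟨a, b, ha, rfl⟩ := this
    exact Finset.le_sup (f := fun ab : V × V => diffCount G ab.1 ab.2) (b := (a, b)) (by simpa)

end Attained

/-! ### Moments and attained values of the Walsh transform -/

section WalshAttained

variable {F : Type*} [Field F] [Algebra (ZMod 2) F]

/-- The trace functional `p ↦ Tr(a₁ p₁ + a₂ p₂)`. -/
noncomputable def traceDot (a : F × F) : F × F →+ ZMod 2 where
  toFun p := Algebra.trace (ZMod 2) F (a.1 * p.1 + a.2 * p.2)
  map_zero' := by simp
  map_add' p r := by simp only [Prod.fst_add, Prod.snd_add, mul_add, map_add]; ring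

theorem traceDot_apply (a p : F × F) :
    traceDot a p = Algebra.trace (ZMod 2) F (a.1 * p.1 + a.2 * p.2) := rfl

theorem traceDot_comm (a p : F × F) : traceDot a p = traceDot p a := by
  simp only [traceDot_apply, mul_comm]

variable [Fintype F]

theorem walsh_eq_sum_sign (G : F × F → F × F) (a b : F × F) :
    walsh G a b = ∑ p, sign (traceDot b (G p) + traceDot a p) := by
  simp only [walsh, sign, traceDot_apply, ← map_add, add_assoc]

theorem exists_trace_mul_ne_zero {y : F} (hy : y ≠ 0) :
    ∃ x, Algebra.trace (ZMod 2) F (x * y) ≠ 0 := by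
  obtain ⟨z, hz⟩ := Algebra.trace_surjective (ZMod 2) F 1
  exact ⟨z / y, by rw [div_mul_cancel₀ _ hy, hz]; decide⟩

theorem traceDot_eq_zero_iff {a : F × F} : traceDot a = 0 ↔ a = 0 := by
  refine ⟨fun h => ?_, ?_⟩
  · by_contra ha
    by_cases h1 : a.1 = 0
    · have h2 : a.2 ≠ 0 := fun h2 => ha (Prod.ext h1 h2)
      obtain ⟨x, hx⟩ := exists_trace_mul_ne_zero h2
      apply hx
      simpa [traceDot_apply, mul_comm] using DFunLike.congr_fun h (0, x)
    · obtain ⟨x, hx⟩ := exists_trace_mul_ne_zero h1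
      apply hx
      simpa [traceDot_apply, mul_comm] using DFunLike.congr_fun h (x, 0)
  · rintro rfl
    ext p
    simp [traceDot_apply]

theorem sum_sign_traceDot [DecidableEq F] (a : F × F) :
    ∑ p, sign (traceDot a p) = if a = 0 then (Fintype.card (F × F) : ℤ) else 0 := by
  classical
  simp_rw [sum_sign_addMonoidHom, traceDot_eq_zero_iff]

theorem walsh_zero_right {a : F × F} (G : F × F → F × F) (ha : a ≠ 0) : walsh G a 0 = 0 := by
  classical
  simp only [walsh_eq_sum_sign, traceDot_eq_zero_iff.2, AddMonoidHom.zero_apply, zero_add,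
    sum_sign_traceDot, if_neg ha]

theorem walsh_zero_left {G : F × F → F × F} (hG : Function.Bijective G) {b : F × F}
    (hb : b ≠ 0) : walsh G 0 b = 0 := by
  classical
  simp only [walsh_eq_sum_sign, traceDot_eq_zero_iff.2, AddMonoidHom.zero_apply, add_zero]
  rw [hG.sum_comp fun p => sign (traceDot b p), sum_sign_traceDot, if_neg hb]

/-- Fourier inversion at the origin. This first moment retains the signs of the coefficients, which
Parseval's identity loses. -/
theorem sum_walsh {G : F × F → F × F} (hG : G 0 = 0) (b : F × F) :
    ∑ a, walsh G a b = (Fintype.card (F × F) : ℤ) := by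
  classical
  simp_rw [walsh_eq_sum_sign, sign_add]
  rw [Finset.sum_comm]
  simp_rw [← Finset.mul_sum, fun p a : F × F => traceDot_comm a p, sum_sign_traceDot]
  simp [hG]

/-- Parseval's identity. -/
theorem sum_sq_walsh (G : F × F → F × F) (b : F × F) :
    ∑ a, walsh G a b ^ 2 = (Fintype.card (F × F) : ℤ) ^ 2 := by
  classical
  have : CharP F 2 := charP_of_injective_algebraMap (algebraMap (ZMod 2) F).injective 2
  have hsq : ∀ z : ZMod 2, sign z * sign z = 1 := by decide
  have h1 (a : F × F) : walsh G a b ^ 2 = ∑ p, ∑ r,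
      sign (traceDot b (G p) + traceDot b (G r)) * sign (traceDot (p + r) a) := by
    rw [walsh_eq_sum_sign, sq, Finset.sum_mul_sum]
    refine Finset.sum_congr rfl fun p _ => Finset.sum_congr rfl fun r _ => ?_
    rw [traceDot_comm (p + r), map_add]
    simp only [sign_add]
    ring
  simp_rw [h1]
  rw [Finset.sum_comm]
  simp_rw [Finset.sum_comm (s := (Finset.univ : Finset (F × F))) (t := Finset.univ)
    (f := fun a r => sign (traceDot b (G _) + traceDot b (G r)) * sign (traceDot (_ + r) a)),
    ← Finset.mul_sum, sum_sign_traceDot]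
  have h2 (p r : F × F) : p + r = 0 ↔ r = p := by
    simp only [Prod.ext_iff, Prod.fst_add, Prod.snd_add, Prod.fst_zero, Prod.snd_zero,
      CharTwo.add_eq_zero, eq_comm]
  simp [h2, sign_add, hsq, sq]

/-- A permutation fixing `0` with squared Walsh coefficients in `{0, 4q²}` takes all three
possible values. -/
theorem walshSpectrum_eq_of_bijective {G : F × F → F × F} (hG : Function.Bijective G)
    (h0 : G 0 = 0) (hF : 2 < Fintype.card F)
    (h : ∀ a b : F × F, b ≠ 0 →
      walsh G a b ^ 2 = 0 ∨ walsh G a b ^ 2 = 4 * (Fintype.card F : ℤ) ^ 2) :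
    walshSpectrum G = {0, 2 * (Fintype.card F : ℤ), -(2 * (Fintype.card F : ℤ))} := by
  set q : ℤ := (Fintype.card F : ℤ) with hq
  have hq2 : 2 < q := by rw [hq]; exact_mod_cast hF
  have hqq : (Fintype.card (F × F) : ℤ) = q ^ 2 := by
    rw [Fintype.card_prod]; push_cast; ring
  have hval (a b : F × F) (hb : b ≠ 0) :
      walsh G a b = 0 ∨ walsh G a b = 2 * q ∨ walsh G a b = -(2 * q) := by
    rcases h a b hb with h1 | h1
    · exact Or.inl (pow_eq_zero_iff two_ne_zero |>.1 h1)
    · exact Or.inr (sq_eq_sq_iff_eq_or_eq_neg.1 (by rw [h1]; ring))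
  obtain ⟨b, hb⟩ := exists_ne (0 : F × F)
  have hs1 := sum_walsh h0 b
  have hs2 := sum_sq_walsh G b
  rw [hqq] at hs1 hs2
  ext w
  constructor
  · rintro ⟨a, b, hb, rfl⟩
    exact hval a b hb
  · rintro (rfl | rfl | rfl)
    · exact ⟨0, b, hb, walsh_zero_left hG hb⟩
    -- Without the value 2q all coefficients are nonpositive, but they add up to q².
    · by_contra hne
      have hle : ∑ a, walsh G a b ≤ 0 := Finset.sum_nonpos fun a _ => by
        rcases hval a b hb with h1 | h1 | h1
        · rw [h1]
        · exact absurd ⟨a, b, hb, h1⟩ hne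
        · rw [h1]; linarith
      nlinarith
    -- Without the value -2q one has W² = 2q·W throughout, so the two moments give q⁴ = 2q³, against
    -- q > 2.
    · by_contra hne
      have heq : ∑ a, walsh G a b ^ 2 = 2 * q * ∑ a, walsh G a b := by
        rw [Finset.mul_sum]
        refine Finset.sum_congr rfl fun a _ => ?_
        rcases hval a b hb with h1 | h1 | h1
        · rw [h1]; ring
        · rw [h1]; ring
        · exact absurd ⟨a, b, hb, h1⟩ hne
      rw [hs1, hs2] at heq
      have hq3 : 0 < q ^ 3 := by positivity
      nlinarith

theorem nonlinearity_eq_of_walshSpectrum {G : F × F → F × F} {m : ℕ}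
    (h : walshSpectrum G = {0, (m : ℤ), -(m : ℤ)}) :
    nonlinearity G = (Fintype.card (F × F) : ℚ) / 2 - (1 / 2) * (m : ℚ) := by
  classical
  unfold nonlinearity
  congr 3
  apply le_antisymm
  · refine Finset.sup_le fun ab hab => ?_
    have : walsh G ab.1 ab.2 ∈ walshSpectrum G := ⟨_, _, by simpa using hab, rfl⟩
    rw [h] at this
    rcases this with h0 | h0 | h0 <;> rw [h0] <;> simp
  · have : (m : ℤ) ∈ walshSpectrum G := by simp [h]
    obtain ⟨a, b, ha, hab⟩ := this
    have := Finset.le_sup (s := Finset.univ.filter fun ab : (F × F) × (F × F) => ab.2 ≠ 0)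
      (f := fun ab : (F × F) × (F × F) => (walsh G ab.1 ab.2).natAbs) (b := (a, b)) (by simpa)
    simpa [hab] using this

end WalshAttained

/-! ### Passing from the closed to the open butterfly -/

section OpenClosed

variable {F : Type*} [Field F] {e : ℕ} (he : Function.Bijective (fun x : F => x ^ e)) (α : F)

/-- The right-hand side is symmetric in `p` and `u`, whence the involution; it also says that the
closed butterfly sends (u.2, p.2) to (u.1, p.1). -/
theorem openButterfly_eq_iff (p u : F × F) :
    openButterfly he α p = u ↔ keyedPerm he α p.2 u.2 = p.1 ∧ keyedPerm he α u.2 p.2 = u.1 := by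
  obtain ⟨u, v⟩ := u
  simp only [openButterfly, Prod.mk.injEq]
  rw [and_comm, Equiv.symm_apply_eq, eq_comm]
  refine and_congr_right fun h => ?_
  rw [← h, Equiv.symm_apply_apply]

theorem openButterfly_involutive : Function.Involutive (openButterfly he α) := fun p => by
  obtain ⟨h1, h2⟩ := (openButterfly_eq_iff he α p _).1 rfl
  exact (openButterfly_eq_iff he α _ _).2 ⟨h2, h1⟩

/-- The parametrisation of the domain of the open butterfly by that of the closed one. -/
noncomputable def unfoldEquiv : F × F ≃ F × F where
  toFun r := (keyedPerm he α r.2 r.1, r.2)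
  invFun p := ((keyedPerm he α p.2).symm p.1, p.2)
  left_inv r := by simp
  right_inv p := by simp

theorem unfoldEquiv_apply (r : F × F) :
    unfoldEquiv he α r = (keyedPerm he α r.2 r.1, r.2) := rfl

theorem openButterfly_unfoldEquiv (r : F × F) :
    openButterfly he α (unfoldEquiv he α r) = (keyedPerm he α r.1 r.2, r.1) :=
  (openButterfly_eq_iff he α _ _).2 ⟨rfl, rfl⟩

theorem diffCount_openButterfly [Fintype F] [CharP F 2] (a b : F × F) :
    diffCount (openButterfly he α) a b
      = diffCount (closedButterfly he α) (b.2, a.2) (b.1, a.1) := by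
  have hadd (u v w : F × F) : u + v = w ↔ u = v + w := by
    simp only [Prod.ext_iff, Prod.fst_add, Prod.snd_add]
    refine and_congr ⟨?_, ?_⟩ ⟨?_, ?_⟩ <;> intro h
    · rw [← h, add_left_comm, CharTwo.add_self_eq_zero, add_zero]
    · rw [h, add_right_comm, CharTwo.add_self_eq_zero, zero_add]
    · rw [← h, add_left_comm, CharTwo.add_self_eq_zero, add_zero]
    · rw [h, add_right_comm, CharTwo.add_self_eq_zero, zero_add]
  refine (Nat.card_congr (Equiv.subtypeEquiv (unfoldEquiv he α) fun r => ?_)).symm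
  rw [hadd, hadd, openButterfly_unfoldEquiv, openButterfly_eq_iff, unfoldEquiv_apply,
    closedButterfly, closedButterfly, Prod.ext_iff, and_comm]
  simp

theorem walsh_openButterfly [Fintype F] [Algebra (ZMod 2) F] (a b : F × F) :
    walsh (openButterfly he α) a b
      = walsh (closedButterfly he α) (b.2, a.2) (b.1, a.1) := by
  unfold walsh
  rw [← Equiv.sum_comp (unfoldEquiv he α)]
  refine Finset.sum_congr rfl fun r _ => ?_
  rw [openButterfly_unfoldEquiv, unfoldEquiv_apply, closedButterfly]
  congr 3
  ring

end OpenClosed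

/-! ### A nondegenerate trace form on the extension -/

section TraceIm

variable {F : Type*} [Field F] [Algebra (ZMod 2) F]

/-- The trace of the coordinate at `ω`. -/
noncomputable def traceIm : QuadExt F →+ ZMod 2 where
  toFun u := Algebra.trace (ZMod 2) F u.im
  map_zero' := by simp
  map_add' u v := by simp

theorem traceIm_apply (u : QuadExt F) : traceIm u = Algebra.trace (ZMod 2) F u.im := rfl

variable [Fintype F]

theorem trace_ringHom (s : F →+* F) (x : F) :
    Algebra.trace (ZMod 2) F (s x) = Algebra.trace (ZMod 2) F x := by
  let f : F ≃ₐ[ZMod 2] F := AlgEquiv.ofRingEquiv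
    (f := RingEquiv.ofBijective s (Finite.injective_iff_bijective.1 s.injective))
    fun r => RingHom.congr_fun (Subsingleton.elim (s.comp (algebraMap (ZMod 2) F))
      (algebraMap (ZMod 2) F)) r
  exact Algebra.trace_eq_of_algEquiv f x

theorem traceIm_quadMap (s : F →+* F) (u : QuadExt F) : traceIm (quadMap s u) = traceIm u :=
  trace_ringHom s u.im

theorem eq_zero_of_traceIm_mul {v : QuadExt F} (h : ∀ u, traceIm (u * v) = 0) : v = 0 := by
  have h1 : v.im = 0 := by
    by_contra h1
    obtain ⟨x, hx⟩ := exists_trace_mul_ne_zero h1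
    exact hx (by simpa [traceIm_apply] using h ⟨x, 0⟩)
  have h2 : v.re = 0 := by
    by_contra h2
    obtain ⟨x, hx⟩ := exists_trace_mul_ne_zero h2
    exact hx (by simpa [traceIm_apply, h1] using h ⟨0, x⟩)
  exact QuadraticAlgebra.ext h2 h1

end TraceIm

/-! ### The closed butterfly as a Gold map -/

section ClosedButterfly

variable {F : Type*} [Field F]

/-- Pairs of elements of `F` as elements of `F(ω)`, after an automorphism of `F`. -/
def toQuad (τ : F ≃+* F) : F × F ≃+ QuadExt F where
  toFun p := ⟨τ p.1, τ p.2⟩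
  invFun u := (τ.symm u.re, τ.symm u.im)
  left_inv p := by simp
  right_inv u := by ext <;> simp
  map_add' p r := by ext <;> simp

theorem toQuad_apply (τ : F ≃+* F) (p : F × F) : toQuad τ p = ⟨τ p.1, τ p.2⟩ := rfl

variable [CharP F 2]

/-- The additive bijection `u + ω v ↦ (v, u + v)`. -/
def ofQuad : QuadExt F ≃+ F × F where
  toFun u := (u.im, u.re + u.im)
  invFun p := ⟨p.2 + p.1, p.1⟩
  left_inv u := by
    ext
    · exact CharTwo.add_cancel_right _ _
    · rfl
  right_inv p := by
    ext
    · rfl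
    · exact CharTwo.add_cancel_right _ _
  map_add' u v := by
    ext
    · rfl
    · simp only [QuadraticAlgebra.re_add, QuadraticAlgebra.im_add, Prod.snd_add]; ring

theorem ofQuad_apply (u : QuadExt F) : ofQuad u = (u.im, u.re + u.im) := rfl

variable {e : ℕ} (hbij : Function.Bijective (fun x : F => x ^ e)) {s : F →+* F} {τ : F ≃+* F}

/-- The closed butterfly with coefficient `1` is linearly equivalent to the Gold function. -/
theorem closedButterfly_eq_gold (he : ∀ x : F, x ^ e = τ x * s (τ x)) (p : F × F) :
    closedButterfly hbij 1 p = ofQuad (gold s (toQuad τ p)) := by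
  have h2 : (2 : F) = 0 := CharTwo.two_eq_zero
  simp only [closedButterfly, keyedPerm_apply, he, one_mul, map_add, ofQuad_apply, gold,
    toQuad_apply, QuadraticAlgebra.re_mul, QuadraticAlgebra.im_mul, re_quadMap, im_quadMap]
  ext
  · linear_combination (τ p.1 * s (τ p.1)) * h2
  · ring

section

variable [Fact (∀ r : F, r ^ 2 ≠ 1 + 1 * r)]

theorem closedButterfly_injective (he : ∀ x : F, x ^ e = τ x * s (τ x))
    (hs : ∀ x, s (s x) = x → x = 0 ∨ x = 1) :
    Function.Injective (closedButterfly hbij 1) := by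
  rw [funext (closedButterfly_eq_gold hbij he)]
  exact ofQuad.injective.comp ((gold_injective hs).comp (toQuad τ).injective)

theorem diffCount_closedButterfly [Fintype F] (he : ∀ x : F, x ^ e = τ x * s (τ x))
    (hs : ∀ x, s (s x) = x → x = 0 ∨ x = 1) {a : F × F} (ha : a ≠ 0) (b : F × F) :
    diffCount (closedButterfly hbij 1) a b = 0 ∨ diffCount (closedButterfly hbij 1) a b = 4 := by
  have h : diffCount (closedButterfly hbij 1) a b =
      Nat.card {u : QuadExt F // gold s (u + toQuad τ a) + gold s u = ofQuad.symm b} := by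
    refine Nat.card_congr (Equiv.subtypeEquiv (toQuad τ).toEquiv fun p => ?_)
    rw [closedButterfly_eq_gold hbij he, closedButterfly_eq_gold hbij he, ← map_add ofQuad,
      map_add (toQuad τ), AddEquiv.toEquiv_eq_coe, EquivLike.coe_coe, AddEquiv.eq_symm_apply]
  rw [h]
  exact card_gold_derivative hs (by simpa using ha) _

end

section

variable [Algebra (ZMod 2) F]

/-- Component functions of a closed butterfly as traces on `F(ω)`. -/
theorem traceDot_closedButterfly (he : ∀ x : F, x ^ e = τ x * s (τ x)) (b p : F × F) :
    traceDot b (closedButterfly hbij 1 p)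
      = traceIm ((⟨b.1, b.2⟩ : QuadExt F) * gold s (toQuad τ p)) := by
  rw [closedButterfly_eq_gold hbij he, traceDot_apply, traceIm_apply, ofQuad_apply,
    QuadraticAlgebra.im_mul]
  congr 1
  ring

variable [Fintype F]

/-- Surjectivity of `gold s` lets the mask be written as gold(c), which is absorbed by scaling the
variable by c. Invariance of the trace under `s` brings the polar form to traceIm(s(u)·(s²(w) + w)),
whose radical is the fixed field F_4 of s². -/
theorem sq_walsh_closedButterfly [Fact (∀ r : F, r ^ 2 ≠ 1 + 1 * r)]
    (he : ∀ x : F, x ^ e = τ x * s (τ x)) (hs : ∀ x, s (s x) = x → x = 0 ∨ x = 1)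
    (a : F × F) {b : F × F} (hb : b ≠ 0) :
    walsh (closedButterfly hbij 1) a b ^ 2 = 0 ∨
      walsh (closedButterfly hbij 1) a b ^ 2 = 4 * (Fintype.card F : ℤ) ^ 2 := by
  have : Finite (QuadExt F) := Finite.of_equiv _ (toQuad (RingEquiv.refl F)).toEquiv
  have hgold : Function.Surjective (gold s) :=
    Finite.surjective_of_injective (gold_injective hs)
  obtain ⟨c, hc⟩ := hgold ⟨b.1, b.2⟩
  have hc0 : c ≠ 0 := by
    rintro rfl
    apply hb
    have h0 : (⟨b.1, b.2⟩ : QuadExt F) = 0 := by rw [← hc]; simp [gold]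
    exact Prod.ext (congrArg QuadraticAlgebra.re h0) (congrArg QuadraticAlgebra.im h0)
  have hsurj : Function.Surjective (quadMap s) :=
    Finite.surjective_of_injective (quadMap s).injective
  let φ : F × F ≃+ QuadExt F := (toQuad τ).trans (AddEquiv.mk' (Equiv.mulLeft₀ c hc0) (mul_add c))
  have hφ (p : F × F) : φ p = c * toQuad τ p := rfl
  let D : QuadExt F →+ QuadExt F :=
    ((quadMap s).comp (quadMap s)).toAddMonoidHom + AddMonoidHom.id _
  have hD (u : QuadExt F) : D u = quadMap s (quadMap s u) + u := rfl
  let B : F × F → F × F →+ ZMod 2 := fun w =>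
    traceIm.comp ((AddMonoidHom.mulRight (D (φ w))).comp
      ((quadMap s).toAddMonoidHom.comp φ.toAddMonoidHom))
  have hB (u w : F × F) : B w u = traceIm (quadMap s (φ u) * D (φ w)) := rfl
  have hBT (u w : F × F) :
      B w u = traceIm (φ u * quadMap s (φ w) + φ w * quadMap s (φ u)) := by
    rw [hB, hD, mul_add, map_add, map_add, ← map_mul, traceIm_quadMap, mul_comm (φ w)]
  let R : AddSubgroup (F × F) := D.ker.comap φ.toAddMonoidHom
  have hmem (w : F × F) : w ∈ R ↔ D (φ w) = 0 := Iff.rfl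
  have hR (w : F × F) : w ∈ R ↔ B w = 0 := by
    rw [hmem]
    constructor
    · intro h
      ext u : 1
      rw [hB, h, mul_zero, map_zero, AddMonoidHom.zero_apply]
    · intro h
      refine eq_zero_of_traceIm_mul fun u => ?_
      obtain ⟨v, rfl⟩ := hsurj u
      obtain ⟨v, rfl⟩ := φ.surjective v
      rw [← hB, h, AddMonoidHom.zero_apply]
  have hcard : Nat.card R = 4 := by
    rw [← card_fixed_quadMap hs]
    refine Nat.card_congr (Equiv.subtypeEquiv φ.toEquiv fun w => ?_)
    rw [hmem, hD, CharTwo.add_eq_zero]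
    refine ⟨quadMap_eq_self_of_quadMap_quadMap hs, fun h => ?_⟩
    change quadMap s (φ w) = φ w at h
    rw [h, h]
  have hQ (p : F × F) : traceDot b (closedButterfly hbij 1 p) = traceIm (gold s (φ p)) := by
    rw [traceDot_closedButterfly hbij he, ← hc, hφ, gold_mul]
  have key := sq_sum_sign_of_polar
    (fun p => traceDot b (closedButterfly hbij 1 p) + traceDot a p) B (fun u w => by
      simp only [hQ, map_add, gold_add, hBT]
      ring) R hR
  rw [hcard, Fintype.card_prod] at key
  rw [walsh_eq_sum_sign]
  refine key.imp_right fun h => h.trans ?_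
  push_cast
  ring

end

end ClosedButterfly

/-! ### Binary weight -/

section TwoWeight

@[simp] theorem twoWeight_zero : twoWeight 0 = 0 := rfl

theorem twoWeight_two_mul_add {c : ℕ} (hc : c < 2) (n : ℕ) :
    twoWeight (2 * n + c) = twoWeight n + c := by
  unfold twoWeight
  rcases Nat.eq_zero_or_pos n with rfl | hn
  · interval_cases c <;> simp
  · rw [add_comm (2 * n), Nat.digits_add 2 one_lt_two c n hc (Or.inr hn.ne'), List.sum_cons,
      add_comm]

theorem twoWeight_two_mul (n : ℕ) : twoWeight (2 * n) = twoWeight n :=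
  twoWeight_two_mul_add two_pos n

theorem twoWeight_eq_zero {n : ℕ} (h : twoWeight n = 0) : n = 0 := by
  induction n using Nat.strong_induction_on with
  | _ n ih =>
    by_contra hn
    have h1 := twoWeight_two_mul_add (Nat.mod_lt n two_pos) (n / 2)
    rw [Nat.div_add_mod, h] at h1
    have := ih (n / 2) (by omega) (by omega)
    omega

theorem twoWeight_succ_le (n : ℕ) : twoWeight (n + 1) ≤ twoWeight n + 1 := by
  induction n using Nat.strong_induction_on with
  | _ n ih =>
    rcases Nat.even_or_odd' n with ⟨c, rfl | rfl⟩
    · rw [twoWeight_two_mul_add one_lt_two, twoWeight_two_mul]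
    · rw [show 2 * c + 1 + 1 = 2 * (c + 1) by ring, twoWeight_two_mul,
        twoWeight_two_mul_add one_lt_two]
      have := ih c (by omega)
      omega

/-- Carries in binary addition can only lose ones. -/
theorem twoWeight_add_le (a b : ℕ) : twoWeight (a + b) ≤ twoWeight a + twoWeight b := by
  induction a using Nat.strong_induction_on generalizing b with
  | _ a ih =>
    rcases Nat.eq_zero_or_pos a with rfl | ha
    · simp
    have ha1 := twoWeight_two_mul_add (Nat.mod_lt a two_pos) (a / 2)
    have hb1 := twoWeight_two_mul_add (Nat.mod_lt b two_pos) (b / 2)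
    rw [Nat.div_add_mod] at ha1 hb1
    have h1 := ih (a / 2) (by omega) (b / 2)
    by_cases hc : a % 2 + b % 2 < 2
    · have h2 := twoWeight_two_mul_add hc (a / 2 + b / 2)
      rw [show 2 * (a / 2 + b / 2) + (a % 2 + b % 2) = a + b by omega] at h2
      omega
    · rw [show a + b = 2 * (a / 2 + (b / 2 + 1)) by omega, twoWeight_two_mul]
      have h3 := twoWeight_succ_le (b / 2)
      have h6 := ih (a / 2) (by omega) (b / 2 + 1)
      omega

theorem twoWeight_two_pow_mul_add (k a : ℕ) {b : ℕ} (hb : b < 2 ^ k) :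
    twoWeight (2 ^ k * a + b) = twoWeight a + twoWeight b := by
  induction k generalizing b with
  | zero =>
    obtain rfl : b = 0 := by simpa using hb
    simp
  | succ k ih =>
    have h1 := twoWeight_two_mul_add (Nat.mod_lt b two_pos) (b / 2)
    have h2 := twoWeight_two_mul_add (Nat.mod_lt b two_pos) (2 ^ k * a + b / 2)
    rw [Nat.div_add_mod] at h1
    have h3 : 2 * (2 ^ k * a + b / 2) + b % 2 = 2 ^ (k + 1) * a + b := by
      rw [pow_succ]
      linarith [Nat.div_add_mod b 2]
    rw [h3, ih (by rw [pow_succ] at hb; omega)] at h2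
    omega

theorem twoWeight_two_pow_mul (k a : ℕ) : twoWeight (2 ^ k * a) = twoWeight a := by
  simpa using twoWeight_two_pow_mul_add k a (b := 0) (by positivity)

theorem twoWeight_two_pow (k : ℕ) : twoWeight (2 ^ k) = 1 := by
  rw [← mul_one (2 ^ k), twoWeight_two_pow_mul]
  exact twoWeight_two_mul_add one_lt_two 0

theorem twoWeight_two_pow_sub_one (k : ℕ) : twoWeight (2 ^ k - 1) = k := by
  induction k with
  | zero => rfl
  | succ k ih =>
    have : 0 < 2 ^ k := by positivity
    rw [show 2 ^ (k + 1) - 1 = 2 * (2 ^ k - 1) + 1 by rw [pow_succ]; omega,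
      twoWeight_two_mul_add one_lt_two, ih]

end TwoWeight

/-! ### The filtration by algebraic degree -/

section DegreeFiltration

variable (F : Type*) [Field F]

/-- The span of the functions `(x, y) ↦ x^r y^s` with `w₂(r) + w₂(s) ≤ d`. -/
def degLE (d : ℕ) : Submodule F (F × F → F) :=
  Submodule.span F {f | ∃ r s, twoWeight r + twoWeight s ≤ d ∧ f = fun p => p.1 ^ r * p.2 ^ s}

variable {F}

theorem degLE_mono {c d : ℕ} (h : c ≤ d) : degLE F c ≤ degLE F d :=
  Submodule.span_mono fun _ ⟨r, s, hrs, hf⟩ => ⟨r, s, hrs.trans h, hf⟩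

theorem mul_mem_degLE {c d : ℕ} {f g : F × F → F} (hf : f ∈ degLE F c) (hg : g ∈ degLE F d) :
    f * g ∈ degLE F (c + d) := by
  have h := Submodule.mul_mem_mul hf hg
  rw [degLE, degLE, Submodule.span_mul_span] at h
  refine Submodule.span_mono ?_ h
  rintro _ ⟨_, ⟨r, s, h1, rfl⟩, _, ⟨r', s', h2, rfl⟩, rfl⟩
  refine ⟨r + r', s + s', ?_, ?_⟩
  · have := twoWeight_add_le r r'
    have := twoWeight_add_le s s'
    omega
  · ext p
    simp only [Pi.mul_apply]
    ring

theorem mul_mem_degLE_of_le {b c d : ℕ} {f g : F × F → F} (hf : f ∈ degLE F b)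
    (hg : g ∈ degLE F c) (h : b + c ≤ d) : f * g ∈ degLE F d :=
  degLE_mono h (mul_mem_degLE hf hg)

theorem one_mem_degLE (d : ℕ) : (1 : F × F → F) ∈ degLE F d :=
  Submodule.subset_span ⟨0, 0, by simp, by ext; simp⟩

theorem fst_pow_mem_degLE (m : ℕ) : (fun p : F × F => p.1 ^ 2 ^ m) ∈ degLE F 1 :=
  Submodule.subset_span ⟨2 ^ m, 0, by simp [twoWeight_two_pow], by ext; simp⟩

theorem snd_pow_mem_degLE (m : ℕ) : (fun p : F × F => p.2 ^ 2 ^ m) ∈ degLE F 1 :=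
  Submodule.subset_span ⟨0, 2 ^ m, by simp [twoWeight_two_pow], by ext; simp⟩

theorem prod_range_mem_degLE {c : ℕ} {f : ℕ → F × F → F} (hf : ∀ m, f m ∈ degLE F c) (n : ℕ) :
    ∏ m ∈ Finset.range n, f m ∈ degLE F (n * c) := by
  induction n with
  | zero => simpa using one_mem_degLE 0
  | succ n ih =>
    rw [Finset.prod_range_succ, Nat.succ_mul]
    exact mul_mem_degLE ih (hf n)

theorem pow_two_pow_mem_degLE [CharP F 2] {d : ℕ} {f : F × F → F} (hf : f ∈ degLE F d)
    (t : ℕ) : f ^ 2 ^ t ∈ degLE F d := by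
  induction hf using Submodule.span_induction with
  | mem f hf =>
    obtain ⟨r, s, h, rfl⟩ := hf
    refine Submodule.subset_span ⟨2 ^ t * r, 2 ^ t * s, ?_, ?_⟩
    · rwa [twoWeight_two_pow_mul, twoWeight_two_pow_mul]
    · ext p
      simp only [Pi.pow_apply, mul_pow, ← pow_mul, mul_comm]
  | zero => rw [zero_pow (by positivity)]; exact Submodule.zero_mem _
  | add f g _ _ hf hg =>
    have : (f + g) ^ 2 ^ t = f ^ 2 ^ t + g ^ 2 ^ t := by
      ext p
      simp only [Pi.pow_apply, Pi.add_apply]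
      exact add_pow_char_pow (f p) (g p) 2 t
    rw [this]
    exact Submodule.add_mem _ hf hg
  | smul c f _ hf => rw [smul_pow]; exact Submodule.smul_mem _ _ hf

/-- Replacing each factor of a product by its part of degree two lowers the degree. -/
theorem prod_add_sub_prod_mem_degLE {a b : ℕ → F × F → F} (ha : ∀ m, a m ∈ degLE F 1)
    (hb : ∀ m, b m ∈ degLE F 2) (n : ℕ) {d : ℕ} (hd : 2 * n ≤ d + 1) :
    ∏ m ∈ Finset.range n, (a m + b m) - ∏ m ∈ Finset.range n, b m ∈ degLE F d := by
  induction n generalizing d with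
  | zero => simp
  | succ n ih =>
    have hab : a n + b n ∈ degLE F 2 :=
      Submodule.add_mem _ (degLE_mono one_le_two (ha n)) (hb n)
    have h1 : (∏ m ∈ Finset.range n, b m) * a n ∈ degLE F d :=
      mul_mem_degLE_of_le (prod_range_mem_degLE hb n) (ha n) (by omega)
    -- For n = 0 the bound `d` may be 1, where `d - 2` truncates.
    rcases Nat.eq_zero_or_pos n with rfl | hn
    · simpa using h1
    · have h2 := mul_mem_degLE_of_le (d := d) (ih (d := d - 2) (by omega)) hab (by omega)
      rw [Finset.prod_range_succ, Finset.prod_range_succ]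
      convert Submodule.add_mem _ h1 h2 using 1
      ring

/-- Functions of degree at most one are sums of a function of `x` and a function of `y`. -/
theorem add_eq_zero_of_mem_degLE_one [CharP F 2] {f : F × F → F} (hf : f ∈ degLE F 1) (x y : F) :
    f (x, y) + f (x, 0) + f (0, y) + f (0, 0) = 0 := by
  have h2 : (2 : F) = 0 := CharTwo.two_eq_zero
  induction hf using Submodule.span_induction with
  | mem f hf =>
    obtain ⟨r, s, h, rfl⟩ := hf
    have : r = 0 ∨ s = 0 := by
      by_contra! hrs
      have := mt twoWeight_eq_zero hrs.1
      have := mt twoWeight_eq_zero hrs.2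
      omega
    rcases this with rfl | rfl
    · simp only [pow_zero, one_mul]
      linear_combination (y ^ s + 0 ^ s) * h2
    · simp only [pow_zero, mul_one]
      linear_combination (x ^ r + 0 ^ r) * h2
  | zero => simp
  | add f g _ _ hf hg => simp only [Pi.add_apply]; linear_combination hf + hg
  | smul c f _ hf => simp only [Pi.smul_apply, smul_eq_mul]; linear_combination c * hf

variable [Fintype F] {k : ℕ} (hF : Fintype.card F = 2 ^ k)
include hF

/-- Replace 2^k·a + b by a + b: x^(2^k) = x holds at 0 as well, and the weight does not grow by
subadditivity. -/
theorem exists_reduced_exponent (hk : k ≠ 0) (r : ℕ) :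
    ∃ r' < Fintype.card F, twoWeight r' ≤ twoWeight r ∧ ∀ x : F, x ^ r = x ^ r' := by
  induction r using Nat.strong_induction_on with
  | _ r ih =>
    rw [hF] at ih ⊢
    by_cases hr : r < 2 ^ k
    · exact ⟨r, hr, le_rfl, fun _ => rfl⟩
    · have hlt : r % 2 ^ k < 2 ^ k := Nat.mod_lt _ (by positivity)
      have h1 := twoWeight_two_pow_mul_add k (r / 2 ^ k) hlt
      have hdm := Nat.div_add_mod r (2 ^ k)
      rw [hdm] at h1
      have hq : 2 ≤ 2 ^ k := Nat.le_self_pow hk 2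
      have hpos : 0 < r / 2 ^ k := Nat.div_pos (not_lt.1 hr) (by positivity)
      obtain ⟨r', h2, h3, h4⟩ := ih (r / 2 ^ k + r % 2 ^ k) (by nlinarith)
      refine ⟨r', h2, h3.trans ((twoWeight_add_le _ _).trans h1.ge), fun x => ?_⟩
      rw [← h4, ← hdm, pow_add, pow_mul, ← hF, FiniteField.pow_card, ← pow_add, hF, hdm]

theorem exists_poly_of_mem_degLE (hk : k ≠ 0) {d : ℕ} {f : F × F → F} (hf : f ∈ degLE F d) :
    ∃ P : MvPolynomial (Fin 2) F, (∀ m ∈ P.support, (∀ j, m j < Fintype.card F) ∧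
      twoWeight (m 0) + twoWeight (m 1) ≤ d) ∧ ∀ x y, MvPolynomial.eval ![x, y] P = f (x, y) := by
  classical
  induction hf using Submodule.span_induction with
  | mem f hf =>
    obtain ⟨r, s, h, rfl⟩ := hf
    obtain ⟨r', hr, hr2, hr3⟩ := exists_reduced_exponent hF hk r
    obtain ⟨s', hs, hs2, hs3⟩ := exists_reduced_exponent hF hk s
    refine ⟨MvPolynomial.monomial (Finsupp.single 0 r' + Finsupp.single 1 s') 1,
      fun m hm => ?_, fun x y => ?_⟩
    · obtain rfl := Finset.mem_singleton.1 (MvPolynomial.support_monomial_subset hm)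
      refine ⟨fun j => ?_, ?_⟩
      · fin_cases j <;> simpa
      · simp
        omega
    · rw [MvPolynomial.eval_monomial,
        Finsupp.prod_add_index' (by simp) (by intros; exact pow_add _ _ _)]
      simp [hr3, hs3]
  | zero => exact ⟨0, by simp, by simp⟩
  | add f g _ _ hf hg =>
    obtain ⟨P, hP, hP2⟩ := hf
    obtain ⟨Q, hQ, hQ2⟩ := hg
    refine ⟨P + Q, fun m hm => ?_, fun x y => by simp [hP2, hQ2]⟩
    exact (Finset.mem_union.1 (MvPolynomial.support_add hm)).elim (hP m) (hQ m)
  | smul c f _ hf =>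
    obtain ⟨P, hP, hP2⟩ := hf
    exact ⟨c • P, fun m hm => hP m (MvPolynomial.support_smul hm),
      fun x y => by simp [hP2, MvPolynomial.smul_eval]⟩

/-- Turns degree bounds into membership in a span, where exponents need not be reduced; uniqueness
of the reduced polynomial gives the converse. -/
theorem algDegreeCoord_le_iff (hk : k ≠ 0) {d : ℕ} {f : F × F → F} :
    algDegreeCoord f ≤ d ↔ f ∈ degLE F d := by
  have hred := (existsUnique_reducedPoly f).choose_spec
  change ((∀ j, (reducedPoly f).degreeOf j < Fintype.card F) ∧
    ∀ x y, MvPolynomial.eval ![x, y] (reducedPoly f) = f (x, y)) ∧ _ at hred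
  constructor
  · intro h
    have hsum : f = ∑ m ∈ (reducedPoly f).support,
        (reducedPoly f).coeff m • fun p : F × F => p.1 ^ m 0 * p.2 ^ m 1 := by
      ext p
      rw [← hred.1.2 p.1 p.2, MvPolynomial.eval_eq']
      simp
    rw [hsum]
    refine Submodule.sum_mem _ fun m hm => Submodule.smul_mem _ _ (Submodule.subset_span ?_)
    exact ⟨m 0, m 1, (Finset.le_sup (f := fun m : Fin 2 →₀ ℕ => twoWeight (m 0) + twoWeight (m 1))
      hm).trans h, rfl⟩
  · intro h
    obtain ⟨P, hP, hP2⟩ := exists_poly_of_mem_degLE hF hk h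
    have hPf : P = reducedPoly f := hred.2 P ⟨fun j => by
      rw [MvPolynomial.degreeOf_lt_iff Fintype.card_pos]
      exact fun m hm => (hP m hm).1 j, hP2⟩
    rw [algDegreeCoord, ← hPf]
    exact Finset.sup_le fun m hm => (hP m hm).2

/-- A reduced monomial has nonzero sum only if both exponents are q - 1, which costs weight 2k. -/
theorem sum_eq_zero_of_mem_degLE (hk : k ≠ 0) {d : ℕ} (hd : d < 2 * k) {f : F × F → F}
    (hf : f ∈ degLE F d) : ∑ p, f p = 0 := by
  induction hf using Submodule.span_induction with
  | mem f hf =>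
    obtain ⟨r, s, h, rfl⟩ := hf
    obtain ⟨r', hr, hr2, hr3⟩ := exists_reduced_exponent hF hk r
    obtain ⟨s', hs, hs2, hs3⟩ := exists_reduced_exponent hF hk s
    simp_rw [hr3, hs3]
    rw [Fintype.sum_prod_type]
    simp only [← Finset.mul_sum, ← Finset.sum_mul]
    have hw := twoWeight_two_pow_sub_one k
    rw [← hF] at hw
    by_cases h1 : r' < Fintype.card F - 1
    · rw [FiniteField.sum_pow_lt_card_sub_one F r' h1, zero_mul]
    by_cases h2 : s' < Fintype.card F - 1
    · rw [FiniteField.sum_pow_lt_card_sub_one F s' h2, mul_zero]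
    obtain rfl : r' = Fintype.card F - 1 := by omega
    obtain rfl : s' = Fintype.card F - 1 := by omega
    omega
  | zero => simp
  | add f g _ _ hf hg => simp [Finset.sum_add_distrib, hf, hg]
  | smul c f _ hf => simp [← Finset.mul_sum, hf]

end DegreeFiltration

/-! ### Leading terms of the partial norm -/

section LeadingTerms

variable {F : Type*} [Field F] {X Y : ℕ → F × F → F}

theorem prod_range_pair {M : Type*} [CommMonoid M] (g : ℕ → M) (n : ℕ) :
    ∏ j ∈ Finset.range n, (g (2 * j) * g (2 * j + 1)) = ∏ m ∈ Finset.range (2 * n), g m := by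
  induction n with
  | zero => simp
  | succ n ih =>
    rw [Finset.prod_range_succ, ih, Nat.mul_succ, Finset.prod_range_succ, Finset.prod_range_succ,
      mul_assoc]

variable (hX : ∀ m, X m ∈ degLE F 1) (hY : ∀ m, Y m ∈ degLE F 1) (hY2 : ∀ m, Y m ^ 2 ∈ degLE F 1)
include hY

theorem mul_mem_degLE_two (l m : ℕ) : Y l * Y m ∈ degLE F 2 :=
  mul_mem_degLE_of_le (hY l) (hY m) le_rfl

include hX

theorem add_mul_mem_degLE_two (l m m' : ℕ) : X l + Y m * Y m' ∈ degLE F 2 :=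
  Submodule.add_mem _ (degLE_mono one_le_two (hX l)) (mul_mem_degLE_two hY m m')

include hY2

theorem mul_sq_mul_mem_degLE_three (l m m' r : ℕ) :
    Y m * Y m' ^ 2 * (X l + Y r * Y m) ∈ degLE F 3 := by
  have h1 : Y m * Y m' ^ 2 * X l ∈ degLE F 3 :=
    mul_mem_degLE_of_le (mul_mem_degLE (hY m) (hY2 m')) (hX l) le_rfl
  have h2 : Y m ^ 2 * Y m' ^ 2 * Y r ∈ degLE F 3 :=
    mul_mem_degLE_of_le (mul_mem_degLE (hY2 m) (hY2 m')) (hY r) le_rfl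
  convert Submodule.add_mem _ h1 h2 using 1
  ring

/-- The first factor times Y₁ is X₀Y₁ + Y₀Y₁². The first summand yields the leading term. The second
is paired with the last factor, which contains Y₀ again by periodicity; the repeated Y's become
squares of weight one, lowering the degree. -/
theorem leading_term_mul_one (n : ℕ) (hper : Y (2 * (n + 1) + 1) = Y 0) :
    (∏ j ∈ Finset.range (n + 2), (X (2 * j) + Y (2 * j) * Y (2 * j + 1))) * Y 1
      - X 0 * ∏ m ∈ Finset.range (2 * (n + 1) + 1), Y (m + 1) ∈ degLE F (2 * (n + 1) + 1) := by
  rw [Finset.prod_range_succ' (fun m => Y (m + 1)),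
    ← prod_range_pair (fun m => Y (m + 1 + 1)) (n + 1),
    Finset.prod_range_succ' (fun j => X (2 * j) + Y (2 * j) * Y (2 * j + 1))]
  have h1 : X 0 * Y 1 * (∏ j ∈ Finset.range (n + 1),
      (X (2 * (j + 1)) + Y (2 * (j + 1)) * Y (2 * (j + 1) + 1))
      - ∏ j ∈ Finset.range (n + 1), Y (2 * (j + 1)) * Y (2 * (j + 1) + 1))
      ∈ degLE F (2 * (n + 1) + 1) :=
    mul_mem_degLE_of_le (mul_mem_degLE (hX 0) (hY 1))
      (prod_add_sub_prod_mem_degLE (fun _ => hX _) (fun _ => mul_mem_degLE_two hY _ _) (n + 1)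
        (d := 2 * n + 1) (by omega)) (by omega)
  have h2 : (∏ j ∈ Finset.range n, (X (2 * (j + 1)) + Y (2 * (j + 1)) * Y (2 * (j + 1) + 1)))
      * (Y 0 * Y 1 ^ 2 * (X (2 * (n + 1)) + Y (2 * (n + 1)) * Y 0))
      ∈ degLE F (2 * (n + 1) + 1) :=
    mul_mem_degLE_of_le (prod_range_mem_degLE (fun _ => add_mul_mem_degLE_two hX hY _ _ _) n)
      (mul_sq_mul_mem_degLE_three hX hY hY2 _ _ _ _) (by omega)
  rw [← hper] at h2
  nth_rewrite 1 [hper] at h2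
  convert Submodule.add_mem _ h1 h2 using 1
  rw [Finset.prod_range_succ (fun j => X (2 * (j + 1)) + Y (2 * (j + 1)) * Y (2 * (j + 1) + 1))]
  simp only [Nat.mul_zero, Nat.zero_add, Nat.mul_succ]
  ring

/-- Mirror image of `leading_term_mul_one`: the last factor supplies the leading term, and Y₁Y₀² is
paired with the first factor. -/
theorem leading_term_mul_zero (n : ℕ) (hper : Y (2 * (n + 1) + 1) = Y 0)
    (hper1 : Y (2 * (n + 1) + 2) = Y 1) :
    (∏ j ∈ Finset.range (n + 2), (X (2 * j + 1) + Y (2 * j + 1) * Y (2 * j + 2))) * Y 0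
      - X (2 * (n + 1) + 1) * ∏ m ∈ Finset.range (2 * (n + 1) + 1), Y m
      ∈ degLE F (2 * (n + 1) + 1) := by
  rw [Finset.prod_range_succ' Y, ← prod_range_pair (fun m => Y (m + 1)) (n + 1),
    Finset.prod_range_succ (fun j => X (2 * j + 1) + Y (2 * j + 1) * Y (2 * j + 2)), hper, hper1]
  have h1 : X (2 * (n + 1) + 1) * Y 0 * (∏ j ∈ Finset.range (n + 1),
      (X (2 * j + 1) + Y (2 * j + 1) * Y (2 * j + 2))
      - ∏ j ∈ Finset.range (n + 1), Y (2 * j + 1) * Y (2 * j + 2)) ∈ degLE F (2 * (n + 1) + 1) :=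
    mul_mem_degLE_of_le (mul_mem_degLE (hX _) (hY 0))
      (prod_add_sub_prod_mem_degLE (fun _ => hX _) (fun _ => mul_mem_degLE_two hY _ _) (n + 1)
        (d := 2 * n + 1) (by omega)) (by omega)
  have h2 : (∏ j ∈ Finset.range n, (X (2 * (j + 1) + 1) + Y (2 * (j + 1) + 1) *
      Y (2 * (j + 1) + 2))) * (Y 1 * Y 0 ^ 2 * (X 1 + Y 2 * Y 1)) ∈ degLE F (2 * (n + 1) + 1) :=
    mul_mem_degLE_of_le (prod_range_mem_degLE (fun _ => add_mul_mem_degLE_two hX hY _ _ _) n)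
      (mul_sq_mul_mem_degLE_three hX hY hY2 _ _ _ _) (by omega)
  convert Submodule.add_mem _ h1 h2 using 1
  rw [Finset.prod_range_succ' (fun j => X (2 * j + 1) + Y (2 * j + 1) * Y (2 * j + 2))]
  simp only [Nat.mul_zero, Nat.zero_add]
  ring

end LeadingTerms

/-! ### Fixed points and norms for x ↦ x^(2^i) -/

section GoldPowers

variable {F : Type*} [Field F] [Fintype F] {k i : ℕ} (hF : Fintype.card F = 2 ^ k)
include hF

/-- Both i and k are periods of x under squaring, hence so is their gcd, which is 1. -/
theorem eq_zero_or_one_of_pow_eq_self (hik : Nat.gcd i k = 1) {x : F} (hx : x ^ 2 ^ i = x) :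
    x = 0 ∨ x = 1 := by
  have h1 (m : ℕ) (hm : x ^ 2 ^ m = x) : Function.IsPeriodicPt (fun y : F => y ^ 2) m x := by
    rw [Function.IsPeriodicPt, Function.IsFixedPt, pow_iterate]
    exact hm
  have h2 := (h1 i hx).gcd (h1 k (by rw [← hF, FiniteField.pow_card]))
  rw [hik] at h2
  have h3 : x ^ 2 = x := h2
  rw [sq] at h3
  rcases eq_or_ne x 0 with h | h
  · exact Or.inl h
  · exact Or.inr (mul_left_cancel₀ h (h3.trans (mul_one x).symm))

theorem pow_two_pow_add_mul (c j : ℕ) (x : F) : x ^ 2 ^ (c + j * k) = x ^ 2 ^ c := by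
  rw [pow_add, pow_mul, mul_comm j, pow_mul 2, ← hF, FiniteField.pow_card_pow]

/-- Raising to the power 2^i permutes the factors cyclically, so the product is a nonzero element of
F_2. -/
theorem prod_conj_eq_one (hik : Nat.gcd i k = 1) {x : F} (hx : x ≠ 0) :
    ∏ m ∈ Finset.range k, x ^ 2 ^ (i * m) = 1 := by
  refine (eq_zero_or_one_of_pow_eq_self hF hik ?_).resolve_left
    (Finset.prod_ne_zero_iff.2 fun m _ => pow_ne_zero _ hx)
  have h0 : x ^ 2 ^ (i * 0) ≠ 0 := pow_ne_zero _ hx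
  refine mul_right_cancel₀ h0 ?_
  rw [← Finset.prod_pow]
  simp_rw [← pow_mul, ← pow_add]
  have hper : x ^ 2 ^ (i * k) = x ^ 2 ^ (i * 0) := by
    simpa using pow_two_pow_add_mul hF 0 i x
  conv_rhs => rw [← hper, ← Finset.prod_range_succ (fun m => x ^ 2 ^ (i * m))]
  rw [Finset.prod_range_succ']
  simp only [Nat.mul_succ]

/-- The norm of `x`, extended by one more conjugate of `x`, is `x`. -/
theorem prod_conj_succ (hik : Nat.gcd i k = 1) (x : F) :
    ∏ m ∈ Finset.range (k + 1), x ^ 2 ^ (i * m) = x := by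
  rcases eq_or_ne x 0 with rfl | hx
  · rw [Finset.prod_range_succ, zero_pow (by positivity), mul_zero]
  · rw [Finset.prod_range_succ, prod_conj_eq_one hF hik hx, one_mul]
    simpa using pow_two_pow_add_mul hF 0 i x

end GoldPowers

/-! ### Algebraic degrees of the butterflies -/

section Degrees

variable {F : Type*} [Field F] {k i t e n : ℕ}

/-- The preimage `R_y⁻¹(x) + y` of `x + y^e` under `z ↦ z^e`, as a partial norm. -/
def goldRoot (k i t n : ℕ) (p : F × F) : F :=
  ∏ j ∈ Finset.range (n + 2), (p.1 ^ 2 ^ (k - t) + p.2 * p.2 ^ 2 ^ i) ^ 2 ^ (i * (2 * j))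

section

variable [CharP F 2]

theorem goldRoot_eq_prod : (goldRoot k i t n : F × F → F) = ∏ j ∈ Finset.range (n + 2),
    ((fun p => p.1 ^ 2 ^ (k - t + i * (2 * j))) +
      (fun p => p.2 ^ 2 ^ (i * (2 * j))) * fun p => p.2 ^ 2 ^ (i * (2 * j + 1))) := by
  ext p
  rw [Finset.prod_apply, goldRoot]
  refine Finset.prod_congr rfl fun j _ => ?_
  simp only [Pi.add_apply, Pi.mul_apply]
  rw [add_pow_char_pow, mul_pow, ← pow_mul, ← pow_mul, ← pow_add, ← pow_add]
  congr 4
  ring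

theorem goldRoot_pow_eq_prod : (goldRoot k i t n : F × F → F) ^ 2 ^ i =
    ∏ j ∈ Finset.range (n + 2), ((fun p => p.1 ^ 2 ^ (k - t + i * (2 * j + 1))) +
      (fun p => p.2 ^ 2 ^ (i * (2 * j + 1))) * fun p => p.2 ^ 2 ^ (i * (2 * j + 2))) := by
  rw [goldRoot_eq_prod, ← Finset.prod_pow]
  refine Finset.prod_congr rfl fun j _ => ?_
  ext p
  simp only [Pi.pow_apply, Pi.add_apply, Pi.mul_apply]
  rw [add_pow_char_pow, mul_pow, show i * (2 * j + 2) = i * (2 * j + 1) + i by ring,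
    show i * (2 * j + 1) = i * (2 * j) + i by ring]
  simp only [← pow_mul, ← pow_add 2, add_assoc]

end

variable [Fintype F] (hF : Fintype.card F = 2 ^ k) (hk : k = 2 * (n + 1) + 1) (hik : Nat.gcd i k = 1)

include hF hk hik

theorem goldRoot_mul_pow (p : F × F) :
    goldRoot k i t n p * goldRoot k i t n p ^ 2 ^ i
      = p.1 ^ 2 ^ (k - t) + p.2 * p.2 ^ 2 ^ i := by
  unfold goldRoot
  set z := p.1 ^ 2 ^ (k - t) + p.2 * p.2 ^ 2 ^ i
  rw [← Finset.prod_pow, ← Finset.prod_mul_distrib]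
  have h := prod_conj_succ hF hik z
  rw [show k + 1 = 2 * (n + 2) by omega, ← prod_range_pair] at h
  refine Eq.trans (Finset.prod_congr rfl fun j _ => ?_) h
  rw [← pow_mul, ← pow_add 2, ← Nat.mul_succ]

variable [CharP F 2] (he : e = (2 ^ i + 1) * 2 ^ t)
  (hbij : Function.Bijective (fun x : F => x ^ e))

include he

theorem algDegree_closedButterfly : algDegree (closedButterfly hbij 1) = 2 := by
  classical
  have hk0 : k ≠ 0 := by omega
  have hpow (x y : F) :
      (x + y) ^ e = (x ^ 2 ^ t + y ^ 2 ^ t) * (x ^ 2 ^ (i + t) + y ^ 2 ^ (i + t)) := by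
    rw [he, add_mul, one_mul, pow_add (x + y), ← pow_add 2, add_pow_char_pow, add_pow_char_pow, mul_comm]
  have hX (m : ℕ) := fst_pow_mem_degLE (F := F) m
  have hY (m : ℕ) := snd_pow_mem_degLE (F := F) m
  have hXY : (fun p : F × F => (p.1 + p.2) ^ e) ∈ degLE F 2 := by
    simp_rw [hpow]
    exact mul_mem_degLE_of_le (Submodule.add_mem _ (hX t) (hY t))
      (Submodule.add_mem _ (hX (i + t)) (hY (i + t))) le_rfl
  have he' (x : F) : x ^ e = x ^ 2 ^ t * x ^ 2 ^ (i + t) := by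
    simpa [he, zero_pow] using hpow x 0
  refine le_antisymm (max_le ((algDegreeCoord_le_iff hF hk0).2 ?_)
    ((algDegreeCoord_le_iff hF hk0).2 ?_)) ?_
  · simp only [closedButterfly, keyedPerm_apply, one_mul]
    refine Submodule.add_mem _ (by simpa only [add_comm] using hXY) ?_
    simp_rw [he']
    exact mul_mem_degLE_of_le (hX _) (hX _) le_rfl
  · simp only [closedButterfly, keyedPerm_apply, one_mul]
    refine Submodule.add_mem _ hXY ?_
    simp_rw [he']
    exact mul_mem_degLE_of_le (hY _) (hY _) le_rfl
  by_contra! hlt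
  have h1 := (algDegreeCoord_le_iff hF hk0).1
    ((le_max_left _ _).trans (Nat.le_of_lt_succ hlt))
  have he0 : e ≠ 0 := by rw [he]; positivity
  -- If the degree were at most one, the second difference at (1, y) would give y^(2^i) = y for
  -- every y, forcing F = F_2.
  have h2 (y : F) : y = 0 ∨ y = 1 := by
    refine eq_zero_or_one_of_pow_eq_self hF hik ?_
    have h3 := add_eq_zero_of_mem_degLE_one h1 1 y
    simp only [closedButterfly, keyedPerm_apply, one_mul, zero_add, add_zero, zero_pow he0,
      CharTwo.add_self_eq_zero, one_pow] at h3
    have h4 : ((y + 1) * (y + 1) ^ 2 ^ i + 1 + y * y ^ 2 ^ i) ^ 2 ^ t = 0 := by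
      rw [← h3, add_pow_char_pow, add_pow_char_pow, he, pow_mul, pow_mul, pow_succ', pow_succ',
        one_pow]
    have h5 := pow_eq_zero_iff (by positivity) |>.1 h4
    rw [add_pow_char_pow, one_pow] at h5
    refine CharTwo.add_eq_zero.1 ?_
    linear_combination h5 - (1 + y * y ^ 2 ^ i) * (CharTwo.two_eq_zero : (2 : F) = 0)
  have h3 : Fintype.card F ≤ 2 := by
    rw [← Finset.card_univ]
    exact (Finset.card_le_card fun y _ => by simpa using h2 y).trans
      (Finset.card_le_two (a := 0) (b := 1))
  rw [hF, hk] at h3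
  have : 2 ^ 3 ≤ 2 ^ (2 * (n + 1) + 1) := Nat.pow_le_pow_right two_pos (by omega)
  omega

variable (ht : t ≤ k)

include ht

theorem goldRoot_pow (p : F × F) : goldRoot k i t n p ^ e = p.1 + p.2 ^ e := by
  have h (x : F) : x ^ e = (x * x ^ 2 ^ i) ^ 2 ^ t := by
    rw [he, pow_mul, pow_succ']
  rw [h, goldRoot_mul_pow hF hk hik, add_pow_char_pow, ← h, ← pow_mul, ← pow_add,
    Nat.sub_add_cancel ht, ← hF, FiniteField.pow_card]

/-- With w = R_y⁻¹(x) + y, the first coordinate is w^e + (w + y)^e; the w^e terms cancel, leaving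
y^e and the cross terms. -/
theorem openButterfly_eq_goldRoot (p : F × F) :
    openButterfly hbij 1 p = (p.2 ^ e + (goldRoot k i t n p * p.2 ^ 2 ^ i
      + goldRoot k i t n p ^ 2 ^ i * p.2) ^ 2 ^ t, goldRoot k i t n p + p.2) := by
  have h (x : F) : x ^ e = (x * x ^ 2 ^ i) ^ 2 ^ t := by
    rw [he, pow_mul, pow_succ']
  have h1 := goldRoot_pow hF hk hik he ht p
  rw [openButterfly_eq_iff]
  simp only [keyedPerm_apply, one_mul]
  set w := goldRoot k i t n p
  rw [CharTwo.add_cancel_right, add_comm p.2, CharTwo.add_cancel_right, h1]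
  refine ⟨CharTwo.add_cancel_right _ _, ?_⟩
  rw [← h1, h (w + p.2), h w, h p.2, ← add_pow_char_pow, ← add_pow_char_pow]
  congr 1
  rw [add_pow_char_pow]
  linear_combination (w * w ^ 2 ^ i) * (CharTwo.two_eq_zero : (2 : F) = 0)

theorem algDegree_openButterfly : algDegree (openButterfly hbij 1) = k := by
  classical
  have hk0 : k ≠ 0 := by omega
  let X : ℕ → F × F → F := fun m p => p.1 ^ 2 ^ (k - t + i * m)
  let Y : ℕ → F × F → F := fun m p => p.2 ^ 2 ^ (i * m)
  have hX (m : ℕ) : X m ∈ degLE F 1 := fst_pow_mem_degLE _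
  have hY (m : ℕ) : Y m ∈ degLE F 1 := snd_pow_mem_degLE _
  have hY2 (m : ℕ) : Y m ^ 2 ∈ degLE F 1 := by
    simpa using pow_two_pow_mem_degLE (hY m) 1
  have hXk : X k = X 0 := by
    ext p
    simpa [X] using pow_two_pow_add_mul hF (k - t) i p.1
  have hYk (m : ℕ) : Y (k + m) = Y m := by
    ext p
    have := pow_two_pow_add_mul hF (i * m) i p.2
    simp only [Y]
    rw [← this]
    congr 2
    ring
  set W : F × F → F := goldRoot k i t n with hW
  have hW1 : W = ∏ j ∈ Finset.range (n + 2), (X (2 * j) + Y (2 * j) * Y (2 * j + 1)) :=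
    goldRoot_eq_prod
  have hW2 : W ^ 2 ^ i =
      ∏ j ∈ Finset.range (n + 2), (X (2 * j + 1) + Y (2 * j + 1) * Y (2 * j + 2)) :=
    goldRoot_pow_eq_prod
  have hlead1 : W * Y 1 - X 0 * ∏ m ∈ Finset.range k, Y m ∈ degLE F k := by
    have := leading_term_mul_one hX hY hY2 n (by rw [← hk]; exact hYk 0)
    rw [← hk, ← hW1] at this
    have hshift : ∏ m ∈ Finset.range k, Y (m + 1) = ∏ m ∈ Finset.range k, Y m := by
      rw [hk, Finset.prod_range_succ, Finset.prod_range_succ', ← hk, show Y k = Y 0 from hYk 0]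
    rwa [hshift] at this
  have hlead2 : W ^ 2 ^ i * Y 0 - X 0 * ∏ m ∈ Finset.range k, Y m ∈ degLE F k := by
    have := leading_term_mul_zero hX hY hY2 n (by rw [← hk]; exact hYk 0)
      (by rw [show 2 * (n + 1) + 2 = k + 1 by omega]; exact hYk 1)
    rwa [← hk, ← hW2, hXk] at this
  -- The formal part of degree k + 1 is the norm of y times one more conjugate, that is, y.
  have hprod : ∏ j ∈ Finset.range (n + 2), Y (2 * j) * Y (2 * j + 1) = Y 0 := by
    rw [prod_range_pair]
    ext p
    rw [Finset.prod_apply, show 2 * (n + 2) = k + 1 by omega, prod_conj_succ hF hik]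
    simp [Y]
  have hWk : W ∈ degLE F k := by
    have h1 := prod_add_sub_prod_mem_degLE (fun j => hX (2 * j))
      (fun j => mul_mem_degLE_two hY (2 * j) (2 * j + 1)) (n + 2) (d := k) (by omega)
    rw [← hW1, hprod] at h1
    simpa using Submodule.add_mem _ h1 (degLE_mono (by omega) (hY 0))
  have hfst : (fun p => (openButterfly hbij 1 p).1) ∈ degLE F k := by
    have h1 : (fun p => (openButterfly hbij 1 p).1)
        = (Y 0 * Y 1) ^ 2 ^ t + (W * Y 1 + W ^ 2 ^ i * Y 0) ^ 2 ^ t := by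
      ext p
      rw [openButterfly_eq_goldRoot hF hk hik he hbij ht, he]
      simp only [Pi.add_apply, Pi.pow_apply, Pi.mul_apply, Y, mul_one, pow_zero, pow_one,
        pow_mul, pow_succ']
      rfl
    rw [h1]
    refine Submodule.add_mem _ (degLE_mono (by omega)
      (pow_two_pow_mem_degLE (mul_mem_degLE_two hY 0 1) t)) (pow_two_pow_mem_degLE ?_ t)
    -- Both leading terms are the same function and cancel in characteristic two.
    convert Submodule.add_mem _ hlead1 hlead2 using 1
    ext p
    simp only [Pi.add_apply, Pi.sub_apply]
    linear_combination ((X 0 * ∏ m ∈ Finset.range k, Y m) p) * (CharTwo.two_eq_zero : (2 : F) = 0)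
  have hsnd_eq : (fun p => (openButterfly hbij 1 p).2) = W + Y 0 := by
    ext p
    rw [openButterfly_eq_goldRoot hF hk hik he hbij ht]
    simp [Y, W]
  have hsnd : (fun p => (openButterfly hbij 1 p).2) ∈ degLE F k := by
    rw [hsnd_eq]
    exact Submodule.add_mem _ hWk (degLE_mono (by omega) (hY 0))
  refine le_antisymm (max_le ((algDegreeCoord_le_iff hF hk0).2 hfst)
    ((algDegreeCoord_le_iff hF hk0).2 hsnd)) ?_
  by_contra! hlt
  have h1 := (algDegreeCoord_le_iff hF hk0).1
    ((le_max_right _ _).trans (Nat.le_sub_one_of_lt hlt))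
  rw [hsnd_eq] at h1
  have h2 : W ∈ degLE F (k - 1) := by
    simpa using Submodule.sub_mem _ h1 (degLE_mono (by omega : 1 ≤ k - 1) (hY 0))
  have hPX : ∏ m ∈ Finset.range (k - 1), X (m + 1) ∈ degLE F (k - 1) := by
    simpa using prod_range_mem_degLE (fun m => hX (m + 1)) (k - 1)
  -- Completing the leading term by the missing conjugates of x gives the product of the norms of x
  -- and y, the indicator of xy ≠ 0, with sum (q - 1)² = 1.
  have h3 : (X 0 * ∏ m ∈ Finset.range k, Y m) * ∏ m ∈ Finset.range (k - 1), X (m + 1)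
      ∈ degLE F (2 * k - 1) := by
    have h4 := mul_mem_degLE_of_le (d := 2 * k - 1) (mul_mem_degLE h2 (hY 1)) hPX (by omega)
    have h5 := mul_mem_degLE_of_le (d := 2 * k - 1) hlead1 hPX (by omega)
    convert Submodule.sub_mem _ h4 h5 using 1
    ring
  have h6 := sum_eq_zero_of_mem_degLE hF hk0 (by omega) h3
  let δ : F → F := fun x => 1 - if x = 0 then 1 else 0
  have hnorm (x : F) : ∏ m ∈ Finset.range k, x ^ 2 ^ (i * m) = δ x := by
    simp only [δ]
    split_ifs with hx
    · rw [hx, sub_self]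
      exact Finset.prod_eq_zero (Finset.mem_range.2 (Nat.pos_of_ne_zero hk0))
        (zero_pow (by positivity))
    · rw [prod_conj_eq_one hF hik hx, sub_zero]
  have hXprod : X 0 * ∏ m ∈ Finset.range (k - 1), X (m + 1) = ∏ m ∈ Finset.range k, X m := by
    rw [mul_comm, ← Finset.prod_range_succ', Nat.sub_add_cancel (by omega)]
  have h7 (p : F × F) : ((X 0 * ∏ m ∈ Finset.range k, Y m)
      * ∏ m ∈ Finset.range (k - 1), X (m + 1)) p
      = δ p.1 * δ p.2 := by
    rw [mul_right_comm, hXprod, Pi.mul_apply, Finset.prod_apply, Finset.prod_apply, hnorm]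
    have hXm (m : ℕ) : X m p = (p.1 ^ 2 ^ (k - t)) ^ 2 ^ (i * m) := by
      rw [← pow_mul, ← pow_add]
    simp_rw [hXm]
    rw [hnorm]
    simp [δ]
  have h8 : ∑ p : F × F, δ p.1 * δ p.2 = 1 := by
    rw [Fintype.sum_prod_type, ← Fintype.sum_mul_sum]
    simp [δ, Finset.sum_sub_distrib]
  rw [Finset.sum_congr rfl fun p _ => h7 p, h8] at h6
  exact one_ne_zero h6

end Degrees

end Butterfly

/-! ### Assembly of the four claims -/

theorem mainTheorem5 {F : Type*} [Field F] [Fintype F] [Algebra (ZMod 2) F]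
    (k i t e : ℕ) (hF : Fintype.card F = 2 ^ k) (hk : Odd k) (hk1 : 1 < k)
    (hik : Nat.gcd i k = 1) (ht : t ≤ k - 1) (he : e = (2 ^ i + 1) * 2 ^ t) :
    ∃ hbij : Function.Bijective (fun x : F => x ^ e),
      (Function.Bijective (Butterfly.openButterfly hbij 1) ∧
        Function.Bijective (Butterfly.closedButterfly hbij 1)) ∧
      (Butterfly.algDegree (Butterfly.openButterfly hbij 1) = k ∧
        Butterfly.algDegree (Butterfly.closedButterfly hbij 1) = 2) ∧
      (Butterfly.diffUniformity (Butterfly.openButterfly hbij 1) = 4 ∧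
        Butterfly.diffUniformity (Butterfly.closedButterfly hbij 1) = 4 ∧
        Butterfly.diffSpectrum (Butterfly.openButterfly hbij 1) = {0, 4} ∧
        Butterfly.diffSpectrum (Butterfly.closedButterfly hbij 1) = {0, 4}) ∧
      (Butterfly.nonlinearity (Butterfly.openButterfly hbij 1) = 2 ^ (2 * k - 1) - 2 ^ k ∧
        Butterfly.nonlinearity (Butterfly.closedButterfly hbij 1) = 2 ^ (2 * k - 1) - 2 ^ k ∧
        Butterfly.walshSpectrum (Butterfly.openButterfly hbij 1)
          = {0, 2 ^ (k + 1), -2 ^ (k + 1)} ∧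
        Butterfly.walshSpectrum (Butterfly.closedButterfly hbij 1)
          = {0, 2 ^ (k + 1), -2 ^ (k + 1)}) := by
  have : CharP F 2 := charP_of_injective_algebraMap (algebraMap (ZMod 2) F).injective 2
  obtain ⟨n, hn⟩ : ∃ n, k = 2 * (n + 1) + 1 := by
    obtain ⟨m, rfl⟩ := hk
    exact ⟨m - 1, by omega⟩
  have h2k : Nat.gcd 2 k = 1 := (Nat.coprime_two_left (n := k)).2 hk
  let s : F →+* F := iterateFrobenius F 2 i
  let τ : F ≃+* F := RingEquiv.ofBijective (iterateFrobenius F 2 t)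
    (Finite.injective_iff_bijective.1 (iterateFrobenius F 2 t).injective)
  have hpow (x : F) : x ^ e = τ x * s (τ x) := by
    change _ = x ^ 2 ^ t * (x ^ 2 ^ t) ^ 2 ^ i
    rw [he, ← pow_succ', ← pow_mul, mul_comm]
  have hs (x : F) (hx : s (s x) = x) : x = 0 ∨ x = 1 := by
    refine Butterfly.eq_zero_or_one_of_pow_eq_self hF (i := i * 2)
      (Nat.Coprime.mul_left hik h2k) ?_
    change (x ^ 2 ^ i) ^ 2 ^ i = x at hx
    rwa [← pow_mul, ← pow_add, ← mul_two] at hx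
  -- A root would satisfy r⁴ = r, hence lie in F_2 because gcd(2, k) = 1.
  have : Fact (∀ r : F, r ^ 2 ≠ 1 + 1 * r) := ⟨fun r hr => by
    have h4 : r ^ 2 ^ 2 = r := by
      have h2 : (2 : F) = 0 := CharTwo.two_eq_zero
      linear_combination (r ^ 2 + 1 + r + 1) * hr + (1 + r) * h2
    rcases Butterfly.eq_zero_or_one_of_pow_eq_self hF h2k h4 with rfl | rfl
    · simp at hr
    · simp [CharTwo.add_self_eq_zero] at hr⟩
  have hbij : Function.Bijective (fun x : F => x ^ e) := by
    refine Finite.injective_iff_bijective.1 fun x y hxy => ?_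
    -- The power map is the restriction of the Gold map to F, after `τ`.
    have h1 (z : F) : Butterfly.gold s ⟨τ z, 0⟩ = ⟨z ^ e, 0⟩ := by
      ext <;> simp [Butterfly.gold, hpow]
    have h2 : Butterfly.gold s ⟨τ x, 0⟩ = Butterfly.gold s ⟨τ y, 0⟩ := by
      rw [h1, h1]
      exact congrArg (fun w => QuadraticAlgebra.mk w 0) hxy
    exact τ.injective (congrArg QuadraticAlgebra.re (Butterfly.gold_injective hs h2))
  have hV : Function.Bijective (Butterfly.closedButterfly hbij 1) :=
    Finite.injective_iff_bijective.1 (Butterfly.closedButterfly_injective hbij hpow hs)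
  have hH : Function.Bijective (Butterfly.openButterfly hbij 1) :=
    (Butterfly.openButterfly_involutive hbij 1).bijective
  have hadd (v : F × F) : v + v = 0 :=
    Prod.ext (CharTwo.add_self_eq_zero v.1) (CharTwo.add_self_eq_zero v.2)
  have hV0 : Butterfly.closedButterfly hbij 1 0 = 0 := by
    simp [Butterfly.closedButterfly, Butterfly.keyedPerm_apply, CharTwo.add_self_eq_zero]
  have hH0 : Butterfly.openButterfly hbij 1 0 = 0 :=
    (Butterfly.openButterfly_eq_iff hbij 1 _ _).2
      (by simp [Butterfly.keyedPerm_apply, CharTwo.add_self_eq_zero])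
  have hdV (a b : F × F) (ha : a ≠ 0) := Butterfly.diffCount_closedButterfly hbij hpow hs ha b
  have hdH (a b : F × F) (ha : a ≠ 0) :
      Butterfly.diffCount (Butterfly.openButterfly hbij 1) a b = 0 ∨
      Butterfly.diffCount (Butterfly.openButterfly hbij 1) a b = 4 := by
    rw [Butterfly.diffCount_openButterfly]
    -- Here the input difference of V vanishes, so a solution would force a = 0.
    by_cases h : (b.2, a.2) = 0
    · left
      rw [h]
      have : IsEmpty {x : F × F // Butterfly.closedButterfly hbij 1 (x + 0) +
          Butterfly.closedButterfly hbij 1 x = (b.1, a.1)} := by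
        refine ⟨fun x => ha ?_⟩
        have h1 := x.2
        rw [add_zero, hadd] at h1
        exact Prod.ext (Prod.ext_iff.1 h1).2.symm (Prod.ext_iff.1 h).2
      exact Nat.card_of_isEmpty
    · exact hdV _ _ h
  have hwV (a b : F × F) (hb : b ≠ 0) := Butterfly.sq_walsh_closedButterfly hbij hpow hs a hb
  have hwH (a b : F × F) (hb : b ≠ 0) :
      Butterfly.walsh (Butterfly.openButterfly hbij 1) a b ^ 2 = 0 ∨
      Butterfly.walsh (Butterfly.openButterfly hbij 1) a b ^ 2 = 4 * (Fintype.card F : ℤ) ^ 2 := by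
    rw [Butterfly.walsh_openButterfly]
    -- Here the output mask of V vanishes while its input mask does not, since b ≠ 0.
    by_cases h : (b.1, a.1) = 0
    · left
      rw [h, Butterfly.walsh_zero_right, zero_pow two_ne_zero]
      exact fun h' => hb (Prod.ext (Prod.ext_iff.1 h).1 (Prod.ext_iff.1 h').1)
    · exact hwV _ _ h
  have hcard : 2 < Fintype.card F := by
    rw [hF]
    calc 2 = 2 ^ 1 := rfl
      _ < 2 ^ k := Nat.pow_lt_pow_right one_lt_two hk1
  have hq : 2 * (Fintype.card F : ℤ) = 2 ^ (k + 1) := by rw [hF]; push_cast; ring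
  have hspec {G : F × F → F × F} (hG : Function.Bijective G) (h0 : G 0 = 0)
      (h : ∀ a b : F × F, b ≠ 0 → Butterfly.walsh G a b ^ 2 = 0 ∨
        Butterfly.walsh G a b ^ 2 = 4 * (Fintype.card F : ℤ) ^ 2) :
      Butterfly.nonlinearity G = 2 ^ (2 * k - 1) - 2 ^ k ∧
        Butterfly.walshSpectrum G = {0, 2 ^ (k + 1), -2 ^ (k + 1)} := by
    have h1 := Butterfly.walshSpectrum_eq_of_bijective hG h0 hcard h
    refine ⟨?_, by rw [h1, hq]⟩
    rw [Butterfly.nonlinearity_eq_of_walshSpectrum (m := 2 ^ (k + 1))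
      (by rw [h1, hq]; push_cast; rfl), Fintype.card_prod, hF]
    have h2 : (2 : ℚ) ^ (2 * k - 1) * 2 = 2 ^ k * 2 ^ k := by
      rw [← pow_succ, ← pow_add]
      congr 1
      omega
    push_cast
    linear_combination -(1 / 2) * h2
  have hsV := Butterfly.diffSpectrum_eq_of_bijective hadd hV hdV
  have hsH := Butterfly.diffSpectrum_eq_of_bijective hadd hH hdH
  obtain ⟨hnV, hwV⟩ := hspec hV hV0 hwV
  obtain ⟨hnH, hwH⟩ := hspec hH hH0 hwH
  exact ⟨hbij, ⟨hH, hV⟩,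
    ⟨Butterfly.algDegree_openButterfly hF hn hik he hbij (by omega),
      Butterfly.algDegree_closedButterfly hF hn hik he hbij⟩,
    ⟨Butterfly.diffUniformity_eq_of_diffSpectrum hsH,
      Butterfly.diffUniformity_eq_of_diffSpectrum hsV, hsH, hsV⟩, hnH, hnV, hwH, hwV⟩
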